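/- **Theorem (Euler-flow approximation).** Let $A,B\subset\mathbb{R}^m$, and let $P_A,P_B$ be metric projections onto $A,B$: at each point they return a nearest point of $A$ (resp. $B$), with an arbitrary fixed choice wherever nearest points are not unique. Put $R_A=2P_A-\mathrm{Id}$ and $v(x)=P_B(R_Ax)-P_Ax$. For $\varepsilon>0$ and $x_0\in\mathbb{R}^m$ let $x_{k+1}=x_k+\varepsilon v(x_k)$ be the RRR iterates and let $x^\varepsilon$ be their piecewise-linear interpolation, $x^\varepsilon(k\varepsilon)=x_k$. Let $K\subset\mathbb{R}^m$ be compact and $T>0$. **(a) Smooth transverse case (S1).** Let $U\supseteq K$ be open and suppose that $A,B$ are closed $C^2$ embedded submanifolds of $\mathbb{R}^m$ that intersect transversally at every point of $A\cap B\cap U$, that nearest points in $A$ are unique on $U$ and $P_A$ is $C^1$ on $U$, and that nearest points in $B$ are unique, and $P_B$ is $C^1$, on an open set containing $R_A(U)$. Suppose that for every $x_0\in K$ the equation $\dot x=v(x)$, $x(0)=x_0$, has a Carathéodory solution on $[0,T]$ that stays in $U$. Then there are $\varepsilon_0>0$ and $C>0$ such that for every $x_0\in K$, every Carathéodory solution $x$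 of $\dot x=v(x)$ on $[0,T]$ with $x(0)=x_0$, and every $0<\varepsilon\le\varepsilon_0$, $$\sup_{t\in[0,T]}\|x^\varepsilon(t)-x(t)\|\le C\varepsilon .$$ **(b) Discrete case (S2).** Let $A,B$ be finite. For $(a,b)\in A\times B$ let $W(a,b)=\{x: P_A(x)=a,\ P_B(R_Ax)=b\}$, and let $\mathcal J$ be the set of multiway junctions, i.e. of the points that lie in the closures of at least three of the sets $W(a,b)$. A Filippov solution on $[0,\tau]$ is an absolutely continuous curve with $\dot x(t)\in\mathcal F(x(t))$ for almost every $t$, where $\mathcal F(x)=\bigcap_{r>0}\bigcap_{|N|=0}\overline{\mathrm{co}}\,v(B(x,r)\setminus N)$. Let $\delta_0>0$. Then there are $\varepsilon_0>0$ and $C>0$ such that the following holds for every $x_0\in K$. Let $x$ be a Filippov solution on $[0,T]$ with $x(0)=x_0$ that is unique (for each $0<\tau\le T$, every Filippov solution on $[0,\tau]$ starting at $x_0$ coincides with $x$ on $[0,\tau]$), and suppose that $\|x(t)-z\|\ge\delta_0$ for all $t\in[0,T]$ and $z\in\mathcal J$. Then for every $0<\varepsilon\le\varepsilon_0$, $$\sup_{t\in[0,T]}\|x^\varepsilon(t)-x(t)\|\le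 C\varepsilon .$$ Here $x$ may cross two-cell interfaces $\partial W(a_1,b_1)\cap\partial W(a_2,b_2)$ and may slide along them; since $A$ and $B$ are finite, there are only finitely many such interfaces. The constants $\varepsilon_0,C$ may depend on $A,B,P_A,P_B,K,T$, in (a) also on $U$ and in (b) also on $\delta_0$, but not on $x_0$, $x$ or $\varepsilon$. -/

import Mathlib

open Set MeasureTheory

noncomputable section

namespace RRR

variable {m : ℕ}

/-- The set-valued metric projection onto `S`: all points of `S` nearest to `x`. -/
def nearestPoints (S : Set (EuclideanSpace ℝ (Fin m))) (x : EuclideanSpace ℝ (Fin m)) :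
    Set (EuclideanSpace ℝ (Fin m)) :=
  {s | s ∈ S ∧ ∀ s' ∈ S, dist x s ≤ dist x s'}

/-- `p` is a (single-valued version of the) metric projection onto `S`: at every point it picks a
nearest point of `S`, with an arbitrary choice where the nearest point is not unique. -/
def IsMetricProjection (S : Set (EuclideanSpace ℝ (Fin m)))
    (p : EuclideanSpace ℝ (Fin m) → EuclideanSpace ℝ (Fin m)) : Prop :=
  ∀ x, p x ∈ nearestPoints S x

/-- The reflector `R = 2 P - Id`. -/
def reflector (p : EuclideanSpace ℝ (Fin m) → EuclideanSpace ℝ (Fin m))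
    (x : EuclideanSpace ℝ (Fin m)) : EuclideanSpace ℝ (Fin m) :=
  (2 : ℝ) • p x - x

/-- The RRR flow field `v(x) = P_B (R_A x) - P_A x`. -/
def flowField (pA pB : EuclideanSpace ℝ (Fin m) → EuclideanSpace ℝ (Fin m))
    (x : EuclideanSpace ℝ (Fin m)) : EuclideanSpace ℝ (Fin m) :=
  pB (reflector pA x) - pA x

/-- The iterates `x_{k+1} = x_k + ε v(x_k)`. -/
def iterates (v : EuclideanSpace ℝ (Fin m) → EuclideanSpace ℝ (Fin m)) (ε : ℝ)
    (x₀ : EuclideanSpace ℝ (Fin m)) : ℕ → EuclideanSpace ℝ (Fin m)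
  | 0 => x₀
  | k + 1 => iterates v ε x₀ k + ε • v (iterates v ε x₀ k)

/-- The piecewise-linear interpolation of the iterates, with value `x_k` at time `k ε`
(used for `0 < ε` and `0 ≤ t`). -/
def interpolation (v : EuclideanSpace ℝ (Fin m) → EuclideanSpace ℝ (Fin m)) (ε : ℝ)
    (x₀ : EuclideanSpace ℝ (Fin m)) (t : ℝ) : EuclideanSpace ℝ (Fin m) :=
  AffineMap.lineMap (iterates v ε x₀ ⌊t / ε⌋₊) (iterates v ε x₀ (⌊t / ε⌋₊ + 1))
    (t / ε - (⌊t / ε⌋₊ : ℝ))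

/-- Absolutely continuous solutions on `[0, T]` of the differential inclusion `x' ∈ F(x)`. -/
def IsInclusionSolution (F : EuclideanSpace ℝ (Fin m) → Set (EuclideanSpace ℝ (Fin m))) (T : ℝ)
    (x : ℝ → EuclideanSpace ℝ (Fin m)) : Prop :=
  AbsolutelyContinuousOnInterval x 0 T ∧
    ∀ᵐ t ∂(volume.restrict (Icc 0 T)), ∃ w ∈ F (x t), HasDerivAt x w t

/-- Carathéodory solutions on `[0, T]` of `x' = v(x)`. -/
def IsCaratheodorySolution (v : EuclideanSpace ℝ (Fin m) → EuclideanSpace ℝ (Fin m)) (T : ℝ)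
    (x : ℝ → EuclideanSpace ℝ (Fin m)) : Prop :=
  IsInclusionSolution (fun y => {v y}) T x

/-- The Filippov regularization: the closed convex hull of the essential values of `v` near `x`. -/
def filippovSet (v : EuclideanSpace ℝ (Fin m) → EuclideanSpace ℝ (Fin m))
    (x : EuclideanSpace ℝ (Fin m)) : Set (EuclideanSpace ℝ (Fin m)) :=
  ⋂ (r : ℝ) (_ : 0 < r) (N : Set (EuclideanSpace ℝ (Fin m))) (_ : volume N = 0),
    closure (convexHull ℝ (v '' (Metric.ball x r \ N)))

/-- Filippov solutions on `[0, T]` of `x' = v(x)`. -/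
def IsFilippovSolution (v : EuclideanSpace ℝ (Fin m) → EuclideanSpace ℝ (Fin m)) (T : ℝ)
    (x : ℝ → EuclideanSpace ℝ (Fin m)) : Prop :=
  IsInclusionSolution (filippovSet v) T x

/-- `x` is the unique Filippov solution of its initial value problem, forward in time up to `T`. -/
def IsUniqueFilippovSolution (v : EuclideanSpace ℝ (Fin m) → EuclideanSpace ℝ (Fin m)) (T : ℝ)
    (x : ℝ → EuclideanSpace ℝ (Fin m)) : Prop :=
  IsFilippovSolution v T x ∧
    ∀ τ : ℝ, 0 < τ → τ ≤ T → ∀ y : ℝ → EuclideanSpace ℝ (Fin m),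
      IsFilippovSolution v τ y → y 0 = x 0 → ∀ t ∈ Icc 0 τ, y t = x t

/-- `C²` embedded submanifolds of `ℝ^m`, given locally as the zero set of a `C²` submersion. -/
def IsC2Submanifold (S : Set (EuclideanSpace ℝ (Fin m))) : Prop :=
  ∀ s ∈ S, ∃ (k : ℕ) (O : Set (EuclideanSpace ℝ (Fin m)))
    (f : EuclideanSpace ℝ (Fin m) → EuclideanSpace ℝ (Fin k)),
    IsOpen O ∧ s ∈ O ∧ ContDiffOn ℝ 2 f O ∧ (∀ x ∈ O, x ∈ S ↔ f x = 0) ∧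
      ∀ x ∈ S ∩ O, Function.Surjective (fderiv ℝ f x)

/-- The tangent space at a point of a submanifold: the span of the (two-sided) tangent cone. -/
def tangentSpaceAt (S : Set (EuclideanSpace ℝ (Fin m))) (x : EuclideanSpace ℝ (Fin m)) :
    Submodule ℝ (EuclideanSpace ℝ (Fin m)) :=
  Submodule.span ℝ (tangentConeAt ℝ S x)

/-- The smooth transverse case on the open set `U`. The projection onto `B` enters the flow field
only at the reflected points `R_A x`, so its regularity is required on an open set containing
`R_A(U)`. -/
structure SmoothTransverseOn (A B : Set (EuclideanSpace ℝ (Fin m)))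
    (pA pB : EuclideanSpace ℝ (Fin m) → EuclideanSpace ℝ (Fin m))
    (U : Set (EuclideanSpace ℝ (Fin m))) : Prop where
  isOpen : IsOpen U
  isClosed_left : IsClosed A
  isClosed_right : IsClosed B
  submanifold_left : IsC2Submanifold A
  submanifold_right : IsC2Submanifold B
  transverse : ∀ x ∈ A ∩ B ∩ U, tangentSpaceAt A x ⊔ tangentSpaceAt B x = ⊤
  unique_left : ∀ x ∈ U, (nearestPoints A x).Subsingleton
  contDiff_left : ContDiffOn ℝ 1 pA U
  regular_right : ∃ V : Set (EuclideanSpace ℝ (Fin m)), IsOpen V ∧ MapsTo (reflector pA) U V ∧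
    (∀ y ∈ V, (nearestPoints B y).Subsingleton) ∧ ContDiffOn ℝ 1 pB V

/-- The W-domain `W(a, b) = {x | P_A x = a, P_B (R_A x) = b}`. -/
def wDomain (pA pB : EuclideanSpace ℝ (Fin m) → EuclideanSpace ℝ (Fin m))
    (a b : EuclideanSpace ℝ (Fin m)) : Set (EuclideanSpace ℝ (Fin m)) :=
  {x | pA x = a ∧ pB (reflector pA x) = b}

/-- Multiway junctions: the points where (the closures of) at least three W-domains meet. -/
def multiwayJunctions (A B : Set (EuclideanSpace ℝ (Fin m)))
    (pA pB : EuclideanSpace ℝ (Fin m) → EuclideanSpace ℝ (Fin m)) :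
    Set (EuclideanSpace ℝ (Fin m)) :=
  {x | 3 ≤ {c : EuclideanSpace ℝ (Fin m) × EuclideanSpace ℝ (Fin m) |
    c ∈ A ×ˢ B ∧ x ∈ closure (wDomain pA pB c.1 c.2)}.encard}

end RRR

end

/-!
# First-order convergence of the RRR iteration to its flow

**Carathéodory and Filippov solutions.** All information about a solution comes from one mean value
inequality (`IsInclusionSolution.inner_sub_le`): a linear functional bounded by `c` on the admissible
velocities grows by at most `c * (b - a)`.

**Smooth case.** The field is `C¹`, hence locally Lipschitz, on `U`. Around a reference solution there
is a tube in which it is Lipschitz; Grönwall's inequality and a first-exit argument keep in the tube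
every solution starting nearby (`IsCaratheodorySolution.dist_lt_of_tube`), and the classical estimate
for Euler's method applies (`euler_error_le`). Compactness of `K` makes the constants uniform.

**Discrete case.** The field is constant on finitely many convex cells (`isCellField_flowField`), and
compactness gives a radius `r` such that at most two cells occur within distance `r` of a point of an
admissible solution. There, two cells with nonempty interior are separated by a hyperplane, so the
field has a value `v₁` on one side and `v₂` on the other (`IsSwitch`). The time interval is cut into
boundedly many windows in which the solution stays in such a ball, and in each of them the error is
multiplied at most by a fixed factor, up to `O(ε)`:

* if the hyperplane is crossed, a piecewise linear change of variables turns the motion into one with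
  constant velocity, and Euler's method errs in one step only (`IsSwitch.error_le_of_crossing`);
* if it attracts from both sides, or from one while the other moves parallel to it, the
  motion along the sliding direction is reproduced exactly and the normal error contracts
  (`IsSwitch.error_le_of_attracting`);
* if neither side pushes towards it, uniqueness forbids the solution to touch it
  (`IsSwitch.eq_of_isUnique`), and Euler's method is exact unless an earlier error has put the iterates
  on the wrong side. This is where stability could fail. But either no error has occurred so far, or
  the solution has met an interface before, and then it keeps a distance from the hyperplane that is
  bounded below (`clearance_le`), because the cells are convex and finite in number.
-/

noncomputable section

namespace RRR

open scoped Topology NNReal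

variable {m : ℕ}

local notation "𝔼" => EuclideanSpace ℝ (Fin m)

section

/-! ### Absolutely continuous solutions of differential inclusions -/

lemma absolutelyContinuousOnInterval_inner {x : ℝ → 𝔼} {a b : ℝ}
    (hx : AbsolutelyContinuousOnInterval x a b) (n : 𝔼) :
    AbsolutelyContinuousOnInterval (fun t => inner ℝ n (x t)) a b := by
  rw [absolutelyContinuousOnInterval_iff] at hx ⊢
  intro ε hε
  obtain ⟨δ, hδ, h⟩ := hx (ε / (‖n‖ + 1)) (by positivity)
  refine ⟨δ, hδ, fun E hE hl => ?_⟩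
  have h1 := h E hE hl
  have h2 : ∀ i, dist (inner ℝ n (x (E.2 i).1)) (inner ℝ n (x (E.2 i).2)) ≤
      (‖n‖ + 1) * dist (x (E.2 i).1) (x (E.2 i).2) := by
    intro i
    rw [Real.dist_eq, ← inner_sub_right, dist_eq_norm]
    refine (abs_real_inner_le_norm _ _).trans ?_
    gcongr
    linarith
  calc _ ≤ ∑ i ∈ Finset.range E.1, (‖n‖ + 1) * dist (x (E.2 i).1) (x (E.2 i).2) :=
        Finset.sum_le_sum fun i _ => h2 i
    _ = (‖n‖ + 1) * ∑ i ∈ Finset.range E.1, dist (x (E.2 i).1) (x (E.2 i).2) := by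
        rw [Finset.mul_sum]
    _ < (‖n‖ + 1) * (ε / (‖n‖ + 1)) := by gcongr
    _ = ε := by field_simp

variable {F : EuclideanSpace ℝ (Fin m) → Set (EuclideanSpace ℝ (Fin m))} {T : ℝ}
  {x : ℝ → EuclideanSpace ℝ (Fin m)}

lemma IsInclusionSolution.continuousOn (hx : IsInclusionSolution F T x) :
    ContinuousOn x (Icc 0 T) := hx.1.continuousOn.mono Icc_subset_uIcc

/-- The mean value inequality: a linear functional bounded on the admissible velocities bounds the
displacement. All further information about solutions is extracted from this inequality. -/
lemma IsInclusionSolution.inner_sub_le (hx : IsInclusionSolution F T x) {a b : ℝ} (ha : 0 ≤ a)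
    (hab : a ≤ b) (hb : b ≤ T) (n : 𝔼) (c : ℝ)
    (h : ∀ t ∈ Ioo a b, ∀ w ∈ F (x t), inner ℝ n w ≤ c) :
    inner ℝ n (x b - x a) ≤ c * (b - a) := by
  have hsub : uIcc a b ⊆ uIcc 0 T := by
    rw [uIcc_of_le hab, uIcc_of_le (ha.trans (hab.trans hb))]
    exact Icc_subset_Icc ha hb
  have hac : AbsolutelyContinuousOnInterval (fun t => inner ℝ n (x t)) a b :=
    absolutelyContinuousOnInterval_inner (hx.1.mono hsub) n
  have hle : ∫ t in a..b, deriv (fun t => inner ℝ n (x t)) t ≤ ∫ _ in a..b, c := by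
    refine intervalIntegral.integral_mono_ae_restrict hab hac.intervalIntegrable_deriv (by simp) ?_
    have h1 := ae_restrict_of_ae_restrict_of_subset (Icc_subset_Icc ha hb) hx.2
    have h2 : ∀ᵐ t ∂(volume.restrict (Icc a b)), t ∈ Ioo a b := by
      rw [← restrict_Ioo_eq_restrict_Icc]
      exact ae_restrict_mem measurableSet_Ioo
    filter_upwards [h1, h2] with t ⟨w, hw, hd⟩ ht
    have : HasDerivAt (fun t => inner ℝ n (x t)) (inner ℝ n w) t := by
      exact (innerSL ℝ n).hasFDerivAt.comp_hasDerivAt t hd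
    rw [this.deriv]
    exact h t ht w hw
  rw [hac.integral_deriv_eq_sub, intervalIntegral.integral_const, smul_eq_mul] at hle
  rw [inner_sub_right]
  linarith

/-- If a linear map takes a single value on the admissible velocities, its composition with the
solution moves with that constant velocity. -/
lemma IsInclusionSolution.map_sub_eq (hx : IsInclusionSolution F T x) {a b : ℝ} (ha : 0 ≤ a)
    (hab : a ≤ b) (hb : b ≤ T) (l : 𝔼 →L[ℝ] 𝔼) (v : 𝔼)
    (h : ∀ t ∈ Ioo a b, ∀ w ∈ F (x t), l w = v) :
    l (x b - x a) = (b - a) • v := by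
  refine ext_inner_left ℝ fun u => ?_
  have key : ∀ u : 𝔼, inner ℝ u (l (x b - x a)) ≤ inner ℝ u v * (b - a) := by
    intro u
    rw [← ContinuousLinearMap.adjoint_inner_left]
    refine hx.inner_sub_le ha hab hb _ _ fun t ht w hw => ?_
    rw [ContinuousLinearMap.adjoint_inner_left, h t ht w hw]
  have h1 := key u
  have h2 := key (-u)
  simp only [inner_neg_left] at h2
  rw [inner_smul_right]
  linarith

lemma IsInclusionSolution.sub_eq (hx : IsInclusionSolution F T x) {a b : ℝ} (ha : 0 ≤ a)
    (hab : a ≤ b) (hb : b ≤ T) (v : 𝔼) (h : ∀ t ∈ Ioo a b, ∀ w ∈ F (x t), w = v) :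
    x b - x a = (b - a) • v :=
  hx.map_sub_eq ha hab hb (ContinuousLinearMap.id ℝ 𝔼) v h

lemma IsInclusionSolution.norm_sub_le (hx : IsInclusionSolution F T x) {a b : ℝ} (ha : 0 ≤ a)
    (hab : a ≤ b) (hb : b ≤ T) (c : 𝔼) (M : ℝ) (hM : 0 ≤ M)
    (h : ∀ t ∈ Ioo a b, ∀ w ∈ F (x t), ‖w - c‖ ≤ M) :
    ‖x b - x a - (b - a) • c‖ ≤ M * (b - a) := by
  set u := x b - x a - (b - a) • c with hu
  have h1 := hx.inner_sub_le ha hab hb u (inner ℝ u c + ‖u‖ * M) fun t ht w hw => by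
    have : inner ℝ u w = inner ℝ u c + inner ℝ u (w - c) := by rw [inner_sub_right]; ring
    rw [this]
    have := real_inner_le_norm u (w - c)
    have h2 := mul_le_mul_of_nonneg_left (h t ht w hw) (norm_nonneg u)
    linarith
  have h2 : inner ℝ u u = inner ℝ u (x b - x a) - (b - a) * inner ℝ u c := by
    conv_lhs => rw [hu, inner_sub_right, inner_smul_right]
  rw [real_inner_self_eq_norm_sq] at h2
  have h3 : ‖u‖ * ‖u‖ ≤ ‖u‖ * (M * (b - a)) := by nlinarith
  rcases (norm_nonneg u).eq_or_lt with h0 | h0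
  · rw [← h0]; exact mul_nonneg hM (by linarith)
  · exact le_of_mul_le_mul_left h3 h0

end

section

/-! ### From grid times to all times -/

variable {v : EuclideanSpace ℝ (Fin m) → EuclideanSpace ℝ (Fin m)}

/-- A bound at the last grid time before `t` yields one at `t`, since both curves have speed at
most `M`. -/
lemma norm_interpolation_sub_le {ε T C M : ℝ} (hε : 0 < ε) {x₀ : 𝔼} {x : ℝ → 𝔼}
    (hgrid : ∀ k : ℕ, k * ε ≤ T → ‖iterates v ε x₀ k - x (k * ε)‖ ≤ C)
    (hspeed : ∀ k : ℕ, k * ε ≤ T → ‖v (iterates v ε x₀ k)‖ ≤ M)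
    (hx : ∀ a b, 0 ≤ a → a ≤ b → b ≤ T → ‖x b - x a‖ ≤ M * (b - a))
    {t : ℝ} (ht : t ∈ Icc 0 T) :
    ‖interpolation v ε x₀ t - x t‖ ≤ C + 2 * M * ε := by
  set k := ⌊t / ε⌋₊ with hk
  have hk1 : (k : ℝ) ≤ t / ε := Nat.floor_le (div_nonneg ht.1 hε.le)
  have hk2 : t / ε < k + 1 := Nat.lt_floor_add_one _
  have hk1' : k * ε ≤ t := (le_div_iff₀ hε).1 hk1
  have hk2' : t < (k + 1) * ε := (div_lt_iff₀ hε).1 hk2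
  have hkT : k * ε ≤ T := hk1'.trans ht.2
  have hM : 0 ≤ M := (norm_nonneg _).trans (hspeed k hkT)
  have e1 : interpolation v ε x₀ t =
      iterates v ε x₀ k + ((t / ε - k) * ε) • v (iterates v ε x₀ k) := by
    rw [interpolation, ← hk, AffineMap.lineMap_apply]
    simp only [iterates, vsub_eq_sub, add_sub_cancel_left, vadd_eq_add, smul_smul]
    rw [add_comm]
  have e2 : interpolation v ε x₀ t - x t = (iterates v ε x₀ k - x (k * ε)) +
      ((t / ε - k) * ε) • v (iterates v ε x₀ k) - (x t - x (k * ε)) := by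
    rw [e1]; abel
  rw [e2]
  have h1 := hgrid k hkT
  have h2 : ‖((t / ε - k) * ε) • v (iterates v ε x₀ k)‖ ≤ ε * M := by
    rw [norm_smul, Real.norm_eq_abs, abs_of_nonneg (mul_nonneg (by linarith) hε.le)]
    refine mul_le_mul ?_ (hspeed k hkT) (norm_nonneg _) hε.le
    nlinarith
  have h3 := hx (k * ε) t (by positivity) hk1' ht.2
  have h4 : M * (t - k * ε) ≤ M * ε := mul_le_mul_of_nonneg_left (by linarith) hM
  refine (norm_sub_le _ _).trans ?_
  have := norm_add_le (iterates v ε x₀ k - x (k * ε))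
    (((t / ε - k) * ε) • v (iterates v ε x₀ k))
  linarith

/-! ### Locally Lipschitz fields -/

/-- A locally Lipschitz field is bounded and Lipschitz, with uniform constants, on all balls of
some fixed radius centred in a compact set. -/
lemma exists_uniform_tube {U Γ : Set (EuclideanSpace ℝ (Fin m))} (hU : IsOpen U)
    (hv : ContDiffOn ℝ 1 v U) (hΓ : IsCompact Γ) (hΓU : Γ ⊆ U) :
    ∃ r > 0, ∃ L : ℝ≥0, ∃ M > 0, ∀ z ∈ Γ, LipschitzOnWith L v (Metric.ball z r) ∧
      ∀ y ∈ Metric.ball z r, ‖v y‖ ≤ M := by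
  refine hΓ.induction_on (p := fun S => ∃ r > 0, ∃ L : ℝ≥0, ∃ M > 0, ∀ z ∈ S,
    LipschitzOnWith L v (Metric.ball z r) ∧ ∀ y ∈ Metric.ball z r, ‖v y‖ ≤ M) ?_ ?_ ?_ ?_
  · exact ⟨1, one_pos, 0, 1, one_pos, by simp⟩
  · rintro s t hst ⟨r, hr, L, M, hM, h⟩
    exact ⟨r, hr, L, M, hM, fun z hz => h z (hst hz)⟩
  · rintro s t ⟨r, hr, L, M, hM, h⟩ ⟨r', hr', L', M', hM', h'⟩
    refine ⟨min r r', lt_min hr hr', max L L', max M M', lt_max_of_lt_left hM, ?_⟩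
    rintro z (hz | hz)
    · exact ⟨((h z hz).1.mono (Metric.ball_subset_ball (min_le_left _ _))).weaken (le_max_left _ _),
        fun y hy => ((h z hz).2 y (Metric.ball_subset_ball (min_le_left _ _) hy)).trans
          (le_max_left _ _)⟩
    · exact ⟨((h' z hz).1.mono (Metric.ball_subset_ball (min_le_right _ _))).weaken
        (le_max_right _ _), fun y hy => ((h' z hz).2 y
          (Metric.ball_subset_ball (min_le_right _ _) hy)).trans (le_max_right _ _)⟩
  · intro z hz
    have hcd : ContDiffAt ℝ 1 v z := hv.contDiffAt (hU.mem_nhds (hΓU hz))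
    obtain ⟨L, t, ht, hL⟩ := hcd.exists_lipschitzOnWith
    have hb : ∀ᶠ y in 𝓝 z, ‖v y‖ < ‖v z‖ + 1 :=
      hcd.continuousAt.norm.eventually_lt continuousAt_const (by linarith)
    obtain ⟨r, hr, hrs⟩ := Metric.mem_nhds_iff.1 (Filter.inter_mem ht hb)
    refine ⟨Metric.ball z (r / 2), mem_nhdsWithin_of_mem_nhds (Metric.ball_mem_nhds _ (by positivity)),
      r / 2, by positivity, L, ‖v z‖ + 1, by positivity, fun y hy => ?_⟩
    have hsub : Metric.ball y (r / 2) ⊆ Metric.ball z r := by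
      refine Metric.ball_subset_ball' ?_
      have := Metric.mem_ball.1 hy
      linarith
    exact ⟨hL.mono fun w hw => (hrs (hsub hw)).1, fun w hw => (hrs (hsub hw)).2.le⟩

lemma caratheodory_bound {T M : ℝ} {x : ℝ → 𝔼} (hx : IsCaratheodorySolution v T x)
    {a b : ℝ} (ha : 0 ≤ a) (hab : a ≤ b) (hb : b ≤ T) (c : 𝔼) (hM : 0 ≤ M)
    (h : ∀ t ∈ Ioo a b, ‖v (x t) - c‖ ≤ M) : ‖x b - x a - (b - a) • c‖ ≤ M * (b - a) := by
  refine IsInclusionSolution.norm_sub_le hx ha hab hb c M hM ?_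
  rintro t ht w rfl
  exact h t ht

/-- Where the field is continuous, a Carathéodory solution satisfies the equation everywhere. -/
lemma IsCaratheodorySolution.hasDerivWithinAt {T : ℝ} {x : ℝ → 𝔼}
    (hx : IsCaratheodorySolution v T x) {t : ℝ} (ht : t ∈ Ico 0 T)
    (hv : ContinuousAt v (x t)) : HasDerivWithinAt x (v (x t)) (Ici t) t := by
  rw [hasDerivWithinAt_iff_isLittleO, Asymptotics.isLittleO_iff]
  intro c hc
  have hcont : ContinuousWithinAt x (Icc t T) t :=
    (hx.continuousOn t ⟨ht.1, ht.2.le⟩).mono (Icc_subset_Icc_left ht.1)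
  have h1 : ∀ᶠ s in 𝓝[Icc t T] t, ‖v (x s) - v (x t)‖ < c := by
    have h2 := (ContinuousAt.comp_continuousWithinAt (f := x) hv hcont).eventually
      (Metric.ball_mem_nhds (v (x t)) hc)
    filter_upwards [h2] with s hs
    rwa [← dist_eq_norm]
  rw [nhdsWithin_Icc_eq_nhdsGE ht.2] at h1
  obtain ⟨u, hu, hus⟩ := (mem_nhdsGE_iff_exists_Ico_subset' ht.2).1 h1
  have h2 : Ico t (min u T) ∈ 𝓝[≥] t := Ico_mem_nhdsGE (lt_min hu ht.2)
  filter_upwards [h2] with s hs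
  have hsT : s < T := hs.2.trans_le (min_le_right _ _)
  have := caratheodory_bound hx ht.1 hs.1 hsT.le (v (x t)) hc.le fun q hq =>
    (hus ⟨hq.1.le, (hq.2.trans hs.2).trans_le (min_le_left _ _)⟩ : _ < _).le
  rwa [Real.norm_eq_abs, abs_of_nonneg (sub_nonneg.2 hs.1)]

/-- Solutions that start near a reference solution stay near it, by Grönwall's inequality and a
first-exit argument; uniqueness is the case of equal initial values. -/
lemma IsCaratheodorySolution.dist_lt_of_tube {T r : ℝ} {x y : ℝ → 𝔼} {L : ℝ≥0}
    (hx : IsCaratheodorySolution v T x) (hy : IsCaratheodorySolution v T y)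
    (htube : ∀ t ∈ Icc 0 T, LipschitzOnWith L v (Metric.ball (x t) r))
    (h0 : dist (y 0) (x 0) * Real.exp (L * T) < r) :
    ∀ t ∈ Icc 0 T, dist (y t) (x t) < r := by
  by_contra! hcon
  obtain ⟨t₀, ht₀, hr₀⟩ := hcon
  have hr : 0 < r := lt_of_le_of_lt (by positivity) h0
  set S := {t ∈ Icc 0 T | r ≤ dist (y t) (x t)} with hS
  have hcx := hx.continuousOn
  have hcy := hy.continuousOn
  have hSc : IsCompact S :=
    isCompact_Icc.of_isClosed_subset
      (isClosed_Icc.isClosed_le continuousOn_const (continuous_dist.comp_continuousOn (hcy.prodMk hcx))) (sep_subset _ _)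
  obtain ⟨t₁, ⟨ht₁, hr₁⟩, hmin⟩ := hSc.exists_isLeast ⟨t₀, ht₀, hr₀⟩
  have hlt : ∀ t ∈ Ico 0 t₁, dist (y t) (x t) < r := by
    intro t ht
    by_contra! hge
    exact absurd (hmin ⟨⟨ht.1, ht.2.le.trans ht₁.2⟩, hge⟩) (not_le.2 ht.2)
  have hsub : ∀ t ∈ Ico 0 t₁, t ∈ Ico 0 T := fun t ht => ⟨ht.1, ht.2.trans_le ht₁.2⟩
  have hcv : ∀ t ∈ Ico 0 t₁, ∀ z, dist z (x t) < r → ContinuousAt v z := fun t ht z hz =>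
    (htube t (Ico_subset_Icc_self (hsub t ht))).continuousOn.continuousAt
      (Metric.isOpen_ball.mem_nhds hz)
  have key := dist_le_of_trajectories_ODE_of_mem (v := fun _ => v)
    (s := fun t => Metric.ball (x t) r) (K := L) (a := 0) (b := t₁) (f := y) (g := x)
    (fun t ht => htube t (Ico_subset_Icc_self (hsub t ht)))
    (hcy.mono (Icc_subset_Icc_right ht₁.2))
    (fun t ht => hy.hasDerivWithinAt (hsub t ht) (hcv t ht _ (hlt t ht)))
    (fun t ht => hlt t ht)
    (hcx.mono (Icc_subset_Icc_right ht₁.2))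
    (fun t ht => hx.hasDerivWithinAt (hsub t ht) (hcv t ht _ (by simpa using hr)))
    (fun t ht => Metric.mem_ball_self hr) le_rfl t₁ ⟨ht₁.1, le_rfl⟩
  have : Real.exp (L * (t₁ - 0)) ≤ Real.exp (L * T) := by
    gcongr; linarith [ht₁.2]
  have := mul_le_mul_of_nonneg_left this (dist_nonneg (x := y 0) (y := x 0))
  linarith

/-- The Euler error along a solution `y` that stays in a tube around `x` in which the field is
bounded and Lipschitz. -/
lemma euler_error_le {T r ε M : ℝ} {x y : ℝ → 𝔼} {L : ℝ≥0} (hε : 0 < ε) (hM : 0 < M)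
    (hy : IsCaratheodorySolution v T y)
    (htube : ∀ t ∈ Icc 0 T, LipschitzOnWith L v (Metric.ball (x t) r) ∧
      ∀ z ∈ Metric.ball (x t) r, ‖v z‖ ≤ M)
    (hyx : ∀ t ∈ Icc 0 T, dist (y t) (x t) < r / 2)
    (hsmall : M * Real.exp (L * T) * ε < r / 2) (k : ℕ) (hk : k * ε ≤ T) :
    ‖iterates v ε (y 0) k - y (k * ε)‖ ≤ M * ε * (Real.exp (L * (k * ε)) - 1) := by
  have hr : ∀ t ∈ Icc 0 T, 0 < r / 2 := fun t ht => dist_nonneg.trans_lt (hyx t ht)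
  induction k with
  | zero => simp [iterates]
  | succ k ih =>
    push_cast at hk ⊢
    have hk0 : (0 : ℝ) ≤ k * ε := by positivity
    have hkT : k * ε ≤ T := by nlinarith
    have hmem : k * ε ∈ Icc 0 T := ⟨hk0, hkT⟩
    have ih := ih hkT
    have hr2 := hr _ hmem
    have hT0 : 0 ≤ T := hk0.trans hkT
    have hexp : Real.exp (L * (k * ε)) ≤ Real.exp (L * T) := by gcongr
    have hexp1 : 1 ≤ Real.exp (L * T) := Real.one_le_exp (by positivity)
    have hMε : M * ε < r / 2 := by nlinarith [mul_pos hM hε]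
    have he : ‖iterates v ε (y 0) k - y (k * ε)‖ < r / 2 := by
      nlinarith [mul_pos hM hε]
    have hspeed : ∀ t ∈ Icc 0 T, ‖v (y t)‖ ≤ M := fun t ht =>
      (htube t ht).2 _ (Metric.mem_ball.2 (by linarith [hyx t ht, hr t ht]))
    have hlip := (htube _ hmem).1
    have hyk : y (k * ε) ∈ Metric.ball (x (k * ε)) r :=
      Metric.mem_ball.2 (by linarith [hyx _ hmem])
    have hXk : iterates v ε (y 0) k ∈ Metric.ball (x (k * ε)) r := by
      rw [Metric.mem_ball]
      have := dist_triangle (iterates v ε (y 0) k) (y (k * ε)) (x (k * ε))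
      rw [dist_eq_norm (iterates v ε (y 0) k) (y (k * ε))] at this
      linarith [hyx _ hmem]
    have hstep : ‖y ((k + 1) * ε) - y (k * ε) - ((k + 1) * ε - k * ε) • v (y (k * ε))‖ ≤
        L * (M * ε) * ((k + 1) * ε - k * ε) := by
      refine caratheodory_bound hy hk0 (by nlinarith) hk _ (by positivity) fun t ht => ?_
      have hkt : k * ε ≤ t := ht.1.le
      have htT : t ≤ T := ht.2.le.trans hk
      have h1 := caratheodory_bound hy hk0 hkt htT 0 hM.le fun q hq => by
        simpa using hspeed q ⟨hk0.trans hq.1.le, hq.2.le.trans htT⟩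
      have h2 : ‖y t - y (k * ε)‖ ≤ M * ε := by
        simp only [smul_zero, sub_zero] at h1
        refine h1.trans (mul_le_mul_of_nonneg_left ?_ hM.le)
        linarith [ht.2]
      have hyt : y t ∈ Metric.ball (x (k * ε)) r := by
        rw [Metric.mem_ball]
        have := dist_triangle (y t) (y (k * ε)) (x (k * ε))
        rw [dist_eq_norm (y t) (y (k * ε))] at this
        linarith [hyx _ hmem]
      have h3 := hlip.dist_le_mul _ hyt _ hyk
      rw [dist_eq_norm, dist_eq_norm] at h3
      exact h3.trans (mul_le_mul_of_nonneg_left h2 L.2)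
    have hL := hlip.dist_le_mul _ hXk _ hyk
    rw [dist_eq_norm, dist_eq_norm] at hL
    set e := ‖iterates v ε (y 0) k - y (k * ε)‖
    have hdecomp : iterates v ε (y 0) (k + 1) - y ((k + 1) * ε) =
        (iterates v ε (y 0) k - y (k * ε)) +
        ε • (v (iterates v ε (y 0) k) - v (y (k * ε))) -
        (y ((k + 1) * ε) - y (k * ε) - ((k + 1) * ε - k * ε) • v (y (k * ε))) := by
      rw [show (k + 1) * ε - k * ε = ε by ring, iterates, smul_sub]
      abel
    have hfin : ‖iterates v ε (y 0) (k + 1) - y ((k + 1) * ε)‖ ≤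
        e + ε * (L * e) + L * (M * ε) * ε := by
      rw [hdecomp]
      refine (norm_sub_le _ _).trans (add_le_add ((norm_add_le _ _).trans ?_) ?_)
      · rw [norm_smul, Real.norm_eq_abs, abs_of_pos hε]
        gcongr
      · refine hstep.trans (le_of_eq (by ring))
    refine hfin.trans ?_
    have hLε : (1 + L * ε) ≤ Real.exp (L * ε) := by
      rw [add_comm]; exact Real.add_one_le_exp _
    have hsplit : Real.exp (L * ((k + 1) * ε)) = Real.exp (L * (k * ε)) * Real.exp (L * ε) := by
      rw [← Real.exp_add]; ring_nf
    rw [hsplit]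
    have hLε0 : (0 : ℝ) ≤ L * ε := by positivity
    have h5 : e * (1 + L * ε) ≤ M * ε * (Real.exp (L * (k * ε)) - 1) * (1 + L * ε) :=
      mul_le_mul_of_nonneg_right ih (by linarith)
    have h6 : M * ε * (Real.exp (L * (k * ε)) * (1 + L * ε)) ≤
        M * ε * (Real.exp (L * (k * ε)) * Real.exp (L * ε)) := by gcongr
    nlinarith

/-- Euler's method converges with order one, uniformly over compact sets of initial values. -/
theorem euler_approximation_of_contDiffOn {K U : Set (EuclideanSpace ℝ (Fin m))} (hK : IsCompact K)
    {T : ℝ} (hU : IsOpen U) (hv : ContDiffOn ℝ 1 v U)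
    (hsol : ∀ x₀ ∈ K, ∃ x : ℝ → 𝔼, IsCaratheodorySolution v T x ∧ x 0 = x₀ ∧
      ∀ t ∈ Icc 0 T, x t ∈ U) :
    ∃ ε₀ : ℝ, 0 < ε₀ ∧ ∃ C : ℝ, 0 < C ∧ ∀ x₀ ∈ K, ∀ x : ℝ → 𝔼,
      IsCaratheodorySolution v T x → x 0 = x₀ → ∀ ε : ℝ, 0 < ε → ε ≤ ε₀ → ∀ t ∈ Icc 0 T,
        ‖interpolation v ε x₀ t - x t‖ ≤ C * ε := by
  refine hK.induction_on (p := fun S => ∃ ε₀ : ℝ, 0 < ε₀ ∧ ∃ C : ℝ, 0 < C ∧ ∀ x₀ ∈ S,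
    ∀ x : ℝ → 𝔼, IsCaratheodorySolution v T x → x 0 = x₀ → ∀ ε : ℝ, 0 < ε → ε ≤ ε₀ →
      ∀ t ∈ Icc 0 T, ‖interpolation v ε x₀ t - x t‖ ≤ C * ε) ?_ ?_ ?_ ?_
  · exact ⟨1, one_pos, 1, one_pos, by simp⟩
  · rintro s t hst ⟨ε₀, hε₀, C, hC, h⟩
    exact ⟨ε₀, hε₀, C, hC, fun x₀ hx₀ => h x₀ (hst hx₀)⟩
  · rintro s t ⟨ε₀, hε₀, C, hC, h⟩ ⟨ε₁, hε₁, C', hC', h'⟩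
    refine ⟨min ε₀ ε₁, lt_min hε₀ hε₁, max C C', lt_max_of_lt_left hC, ?_⟩
    rintro x₀ (hx₀ | hx₀) x hx h0 ε hε hle q hq
    · refine (h x₀ hx₀ x hx h0 ε hε (hle.trans (min_le_left _ _)) q hq).trans ?_
      gcongr; exact le_max_left _ _
    · refine (h' x₀ hx₀ x hx h0 ε hε (hle.trans (min_le_right _ _)) q hq).trans ?_
      gcongr; exact le_max_right _ _
  · intro z hz
    obtain ⟨x, hx, hx0, hxU⟩ := hsol z hz
    have hΓ : IsCompact (x '' Icc 0 T) := isCompact_Icc.image_of_continuousOn hx.continuousOn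
    obtain ⟨r, hr, L, M, hM, htube⟩ := exists_uniform_tube hU hv hΓ (image_subset_iff.2 hxU)
    have htube' : ∀ t ∈ Icc 0 T, LipschitzOnWith L v (Metric.ball (x t) r) ∧
      ∀ z ∈ Metric.ball (x t) r, ‖v z‖ ≤ M := fun t ht => htube _ (mem_image_of_mem x ht)
    have hE := Real.exp_pos (L * T)
    refine ⟨Metric.ball z (r / 2 / Real.exp (L * T)),
      mem_nhdsWithin_of_mem_nhds (Metric.ball_mem_nhds _ (by positivity)),
      r / 4 / (M * Real.exp (L * T)), by positivity, M * Real.exp (L * T) + 2 * M, by positivity, ?_⟩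
    rintro y₀ hy₀ y hy rfl ε hε hle t ht
    have hsmall : M * Real.exp (L * T) * ε < r / 2 := by
      rw [le_div_iff₀ (by positivity)] at hle
      nlinarith
    have hyx : ∀ t ∈ Icc 0 T, dist (y t) (x t) < r / 2 := by
      refine hx.dist_lt_of_tube hy (L := L)
        (fun t ht => (htube' t ht).1.mono (Metric.ball_subset_ball (by linarith))) ?_
      rw [hx0]
      exact (lt_div_iff₀ hE).1 hy₀
    have hspeed : ∀ t ∈ Icc 0 T, ‖v (y t)‖ ≤ M := fun t ht =>
      (htube' t ht).2 _ (Metric.mem_ball.2 (by linarith [hyx t ht]))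
    have hgrid : ∀ k : ℕ, k * ε ≤ T →
        ‖iterates v ε (y 0) k - y (k * ε)‖ ≤ M * ε * Real.exp (L * T) := by
      intro k hk
      refine (euler_error_le hε hM hy htube' hyx hsmall k hk).trans ?_
      have : Real.exp (L * (k * ε)) ≤ Real.exp (L * T) := by gcongr
      gcongr
      linarith
    refine (norm_interpolation_sub_le hε hgrid (M := M) ?_ ?_ ht).trans (le_of_eq (by ring))
    · intro k hk
      have hk' : k * ε ∈ Icc 0 T := ⟨by positivity, hk⟩
      refine (htube' _ hk').2 _ ?_
      rw [Metric.mem_ball]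
      have h1 := dist_triangle (iterates v ε (y 0) k) (y (k * ε)) (x (k * ε))
      rw [dist_eq_norm (iterates v ε (y 0) k) (y (k * ε))] at h1
      linarith [hyx _ hk', hgrid k hk]
    · intro a b ha hab hb
      simpa using caratheodory_bound hy ha hab hb 0 hM.le fun q hq => by
        simpa using hspeed q ⟨ha.trans hq.1.le, hq.2.le.trans hb⟩

lemma SmoothTransverseOn.contDiffOn_flowField {A B U : Set (EuclideanSpace ℝ (Fin m))}
    {pA pB : EuclideanSpace ℝ (Fin m) → EuclideanSpace ℝ (Fin m)}
    (h : SmoothTransverseOn A B pA pB U) : ContDiffOn ℝ 1 (flowField pA pB) U := by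
  obtain ⟨V, -, hmaps, -, hB⟩ := h.regular_right
  have hR : ContDiffOn ℝ 1 (reflector pA) U := (h.contDiff_left.const_smul (2 : ℝ)).sub contDiffOn_id
  exact (hB.comp hR hmaps).sub h.contDiff_left

end

section

/-! ### The Filippov set -/

variable {v : EuclideanSpace ℝ (Fin m) → EuclideanSpace ℝ (Fin m)}

lemma filippovSet_subset {y : 𝔼} {S : Set (EuclideanSpace ℝ (Fin m))} (hS : Convex ℝ S)
    (hSc : IsClosed S) (h : ∀ᶠ y' in 𝓝 y, v y' ∈ S) : filippovSet v y ⊆ S := by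
  obtain ⟨r, hr, hrS⟩ := Metric.mem_nhds_iff.1 h
  intro w hw
  simp only [filippovSet, mem_iInter] at hw
  refine closure_minimal (convexHull_min ?_ hS) hSc (hw r hr ∅ measure_empty)
  rintro _ ⟨y', hy', rfl⟩
  exact hrS hy'.1

/-- Null sets cannot remove a value that is taken on an open set accumulating at the point. -/
lemma mem_filippovSet {y w : 𝔼} {O : Set (EuclideanSpace ℝ (Fin m))} (hO : IsOpen O)
    (hyO : y ∈ closure O) (hw : ∀ y' ∈ O, v y' = w) : w ∈ filippovSet v y := by
  simp only [filippovSet, mem_iInter]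
  intro r hr N hN
  have hne : (Metric.ball y r ∩ O).Nonempty :=
    mem_closure_iff.1 hyO _ Metric.isOpen_ball (Metric.mem_ball_self hr)
  have hpos := (Metric.isOpen_ball.inter hO).measure_pos volume hne
  have : ((Metric.ball y r ∩ O) \ N).Nonempty := by
    rw [← measure_sdiff_null hN] at hpos
    exact nonempty_of_measure_ne_zero hpos.ne'
  obtain ⟨y', ⟨hy'r, hy'O⟩, hy'N⟩ := this
  exact subset_closure (subset_convexHull ℝ _ ⟨y', ⟨hy'r, hy'N⟩, hw y' hy'O⟩)

lemma norm_le_of_mem_filippovSet {M : ℝ} (hM : ∀ y, ‖v y‖ ≤ M) {y w : 𝔼}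
    (hw : w ∈ filippovSet v y) : ‖w‖ ≤ M := by
  have := filippovSet_subset (v := v) (convex_closedBall (0 : 𝔼) M) Metric.isClosed_closedBall
    (Filter.Eventually.of_forall fun y' => by simpa using hM y') hw
  simpa using this

lemma IsFilippovSolution.norm_sub_le_mul {T M : ℝ} {x : ℝ → 𝔼} (hx : IsFilippovSolution v T x)
    (hM : ∀ y, ‖v y‖ ≤ M) {a b : ℝ} (ha : 0 ≤ a) (hab : a ≤ b) (hb : b ≤ T) :
    ‖x b - x a‖ ≤ M * (b - a) := by
  simpa using IsInclusionSolution.norm_sub_le hx ha hab hb 0 M ((norm_nonneg _).trans (hM 0))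
    fun t _ w hw => by simpa using norm_le_of_mem_filippovSet hM hw

/-- A straight continuation that is compatible with the Filippov set must be the one taken by a
unique solution. -/
lemma IsUniqueFilippovSolution.eq_linear {T M : ℝ} {x : ℝ → 𝔼}
    (hx : IsUniqueFilippovSolution v T x) (hM : ∀ y, ‖v y‖ ≤ M) {t₁ τ : ℝ} (h₁ : 0 ≤ t₁)
    (h₁τ : t₁ < τ) (hτ : τ ≤ T) {w : 𝔼}
    (hw : ∀ t ∈ Icc t₁ τ, w ∈ filippovSet v (x t₁ + (t - t₁) • w)) :
    x τ = x t₁ + (τ - t₁) • w := by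
  classical
  set y : ℝ → 𝔼 := fun t => if t ≤ t₁ then x t else x t₁ + (t - t₁) • w with hy
  have hM0 : 0 ≤ M := (norm_nonneg _).trans (hM 0)
  have hwM : ‖w‖ ≤ M := norm_le_of_mem_filippovSet hM (hw t₁ ⟨le_rfl, h₁τ.le⟩)
  have hlin : ∀ a b : ℝ, a ≤ b → ‖(x t₁ + (b - t₁) • w) - (x t₁ + (a - t₁) • w)‖ ≤ M * (b - a) := by
    intro a b hab
    rw [add_sub_add_left_eq_sub, ← sub_smul, norm_smul, Real.norm_eq_abs, sub_sub_sub_cancel_right,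
      abs_of_nonneg (sub_nonneg.2 hab), mul_comm]
    exact mul_le_mul_of_nonneg_right hwM (sub_nonneg.2 hab)
  have hylip : ∀ a b : ℝ, 0 ≤ a → a ≤ b → b ≤ τ → ‖y b - y a‖ ≤ M * (b - a) := by
    intro a b ha hab hb
    simp only [hy]
    by_cases hb1 : b ≤ t₁
    · rw [if_pos hb1, if_pos (hab.trans hb1)]
      exact hx.1.norm_sub_le_mul hM ha hab (hb.trans hτ)
    · by_cases ha1 : a ≤ t₁
      · rw [if_neg hb1, if_pos ha1]
        have e1 := hx.1.norm_sub_le_mul hM ha ha1 (h₁τ.le.trans hτ)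
        have e2 := hlin t₁ b (not_le.1 hb1).le
        simp only [sub_self, zero_smul, add_zero] at e2
        have e3 := norm_add_le (x t₁ + (b - t₁) • w - x t₁) (x t₁ - x a)
        rw [sub_add_sub_cancel] at e3
        linarith
      · rw [if_neg hb1, if_neg ha1]
        exact hlin a b hab
  have hyF : IsFilippovSolution v τ y := by
    refine ⟨?_, ?_⟩
    · refine LipschitzOnWith.absolutelyContinuousOnInterval (K := M.toNNReal) ?_
      rw [uIcc_of_le (h₁.trans h₁τ.le)]
      refine LipschitzOnWith.of_dist_le_mul fun a ha b hb => ?_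
      rw [Real.coe_toNNReal M hM0]
      rcases le_total a b with hab | hab
      · rw [dist_comm, dist_eq_norm, dist_comm, Real.dist_eq, abs_of_nonneg (sub_nonneg.2 hab)]
        exact hylip a b ha.1 hab hb.2
      · rw [dist_eq_norm, Real.dist_eq, abs_of_nonneg (sub_nonneg.2 hab)]
        exact hylip b a hb.1 hab ha.2
    · have h1 := ae_restrict_of_ae_restrict_of_subset (Icc_subset_Icc_right hτ) hx.1.2
      have h2 : ∀ᵐ t ∂(volume.restrict (Icc 0 τ)), t ≠ t₁ :=
        ae_restrict_of_ae (Measure.ae_ne volume t₁)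
      filter_upwards [h1, h2, ae_restrict_mem measurableSet_Icc] with t ⟨u, hu, hd⟩ hne ht
      rcases lt_or_gt_of_ne hne with hlt | hgt
      · refine ⟨u, ?_, hd.congr_of_eventuallyEq ?_⟩
        · simpa only [hy, if_pos hlt.le] using hu
        · filter_upwards [Iio_mem_nhds hlt] with s hs
          simp only [hy, if_pos (le_of_lt (mem_Iio.1 hs))]
      · refine ⟨w, ?_, ?_⟩
        · simpa only [hy, if_neg (not_le.2 hgt)] using hw t ⟨hgt.le, ht.2⟩
        · have hd' : HasDerivAt (fun s : ℝ => x t₁ + (s - t₁) • w) w t := by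
            simpa using (((hasDerivAt_id t).sub_const t₁).smul_const w).const_add (x t₁)
          refine hd'.congr_of_eventuallyEq ?_
          filter_upwards [Ioi_mem_nhds hgt] with s hs
          simp only [hy, if_neg (not_le.2 (mem_Ioi.1 hs))]
  have := hx.2 τ (h₁.trans_lt h₁τ) hτ y hyF (by simp [hy, h₁]) τ ⟨h₁.trans h₁τ.le, le_rfl⟩
  rw [← this]
  simp only [hy, if_neg (not_le.2 h₁τ)]

/-! ### A field that switches between two velocities at a hyperplane -/

/-- On the ball `B(z, r)` the field `v` equals `v₁` on the side `⟪n, y⟫ < γ` of a hyperplane and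
`v₂` on the other side; on the hyperplane itself it is one of the two. -/
structure IsSwitch (v : EuclideanSpace ℝ (Fin m) → EuclideanSpace ℝ (Fin m)) (z : 𝔼) (r : ℝ)
    (n : 𝔼) (γ : ℝ) (v₁ v₂ : 𝔼) : Prop where
  norm_eq : ‖n‖ = 1
  left : ∀ y ∈ Metric.ball z r, inner ℝ n y < γ → v y = v₁
  right : ∀ y ∈ Metric.ball z r, γ < inner ℝ n y → v y = v₂
  either : ∀ y ∈ Metric.ball z r, v y = v₁ ∨ v y = v₂

namespace IsSwitch

variable {z n v₁ v₂ : EuclideanSpace ℝ (Fin m)} {r γ : ℝ}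

lemma symm (h : IsSwitch v z r n γ v₁ v₂) : IsSwitch v z r (-n) (-γ) v₂ v₁ where
  norm_eq := by rw [norm_neg, h.norm_eq]
  left y hy hlt := h.right y hy (by rw [inner_neg_left] at hlt; linarith)
  right y hy hlt := h.left y hy (by rw [inner_neg_left] at hlt; linarith)
  either y hy := (h.either y hy).symm

lemma eq_of_mem_filippovSet (h : IsSwitch v z r n γ v₁ v₂) {y : 𝔼} (hy : y ∈ Metric.ball z r)
    (hlt : inner ℝ n y < γ) {w : 𝔼} (hw : w ∈ filippovSet v y) : w = v₁ := by
  refine filippovSet_subset (convex_singleton v₁) isClosed_singleton ?_ hw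
  have h1 : ∀ᶠ y' in 𝓝 y, inner ℝ n y' < γ :=
    (by fun_prop : ContinuousAt (fun y' : 𝔼 => (inner ℝ n y' : ℝ)) y).eventually_lt
      continuousAt_const hlt
  filter_upwards [h1, Metric.isOpen_ball.mem_nhds hy] with y' h1 h2
  exact h.left y' h2 h1

lemma mem_segment_of_mem_filippovSet (h : IsSwitch v z r n γ v₁ v₂) {y : 𝔼}
    (hy : y ∈ Metric.ball z r) {w : 𝔼} (hw : w ∈ filippovSet v y) : w ∈ segment ℝ v₁ v₂ := by
  refine filippovSet_subset (convex_segment v₁ v₂) ?_ ?_ hw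
  · rw [segment_eq_image_lineMap]
    exact (isCompact_Icc.image AffineMap.lineMap_continuous).isClosed
  · filter_upwards [Metric.isOpen_ball.mem_nhds hy] with y' hy'
    rcases h.either y' hy' with e | e <;> rw [e]
    exacts [left_mem_segment ℝ v₁ v₂, right_mem_segment ℝ v₁ v₂]

lemma mem_closure_left (h : IsSwitch v z r n γ v₁ v₂) {y : 𝔼} (hy : y ∈ Metric.ball z r)
    (hle : inner ℝ n y ≤ γ) : y ∈ closure (Metric.ball z r ∩ {y' | inner ℝ n y' < γ}) := by
  have hc : Filter.Tendsto (fun s : ℝ => y - s • n) (𝓝[>] 0) (𝓝 y) := by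
    have : ContinuousAt (fun s : ℝ => y - s • n) 0 := by fun_prop
    simpa [ContinuousAt] using this.tendsto.mono_left nhdsWithin_le_nhds
  refine mem_closure_of_tendsto hc ?_
  filter_upwards [hc (Metric.isOpen_ball.mem_nhds hy), self_mem_nhdsWithin] with s hs hs0
  refine ⟨hs, ?_⟩
  simp only [mem_ofPred_eq, inner_sub_right, inner_smul_right, real_inner_self_eq_norm_sq, h.norm_eq]
  have : (0 : ℝ) < s := hs0
  linarith

lemma left_mem_filippovSet (h : IsSwitch v z r n γ v₁ v₂) {y : 𝔼} (hy : y ∈ Metric.ball z r)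
    (hle : inner ℝ n y ≤ γ) : v₁ ∈ filippovSet v y :=
  mem_filippovSet
    (Metric.isOpen_ball.inter (isOpen_lt (by fun_prop) continuous_const))
    (h.mem_closure_left hy hle) fun y' hy' => h.left y' hy'.1 hy'.2

/-- If neither velocity points towards the hyperplane, both sides offer a straight continuation
from a point of the hyperplane. -/
lemma eq_of_isUnique (h : IsSwitch v z r n γ v₁ v₂) {T M : ℝ} {x : ℝ → 𝔼}
    (hx : IsUniqueFilippovSolution v T x) (hM : ∀ y, ‖v y‖ ≤ M) {t₁ : ℝ} (h₁ : 0 ≤ t₁)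
    (h₁T : t₁ < T) (hz : x t₁ ∈ Metric.ball z r) (hγ : inner ℝ n (x t₁) = γ)
    (hα : inner ℝ n v₁ ≤ 0) (hβ : 0 ≤ inner ℝ n v₂) : v₁ = v₂ := by
  have main : ∀ (n' v₁' v₂' : 𝔼) (γ' : ℝ), IsSwitch v z r n' γ' v₁' v₂' →
      inner ℝ n' (x t₁) = γ' → inner ℝ n' v₁' ≤ 0 →
      ∀ᶠ τ in 𝓝[>] t₁, x τ = x t₁ + (τ - t₁) • v₁' := by
    intro n' v₁' v₂' γ' h' hγ' hα'
    have hc : ContinuousAt (fun t : ℝ => x t₁ + (t - t₁) • v₁') t₁ := by fun_prop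
    have hev : ∀ᶠ t in 𝓝 t₁, x t₁ + (t - t₁) • v₁' ∈ Metric.ball z r :=
      hc.eventually_mem (by simpa using Metric.isOpen_ball.mem_nhds hz)
    obtain ⟨u, hu, hus⟩ := (mem_nhdsGE_iff_exists_Ico_subset' h₁T).1
      (mem_nhdsWithin_of_mem_nhds hev : _ ∈ 𝓝[≥] t₁)
    filter_upwards [Ioo_mem_nhdsGT (lt_min hu h₁T : t₁ < min u T)] with τ hτ
    refine hx.eq_linear hM h₁ hτ.1 (hτ.2.le.trans (min_le_right _ _)) fun t ht => ?_
    refine h'.left_mem_filippovSet (hus ⟨ht.1, ht.2.trans_lt (hτ.2.trans_le (min_le_left _ _))⟩) ?_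
    rw [inner_add_right, inner_smul_right, hγ']
    nlinarith [ht.1]
  have e1 := main n v₁ v₂ γ h hγ hα
  have e2 := main (-n) v₂ v₁ (-γ) h.symm (by rw [inner_neg_left, hγ])
    (by rw [inner_neg_left]; linarith)
  obtain ⟨τ, ⟨h1, h2⟩, h3⟩ := ((e1.and e2).and self_mem_nhdsWithin).exists
  have h4 : (τ - t₁) • v₁ = (τ - t₁) • v₂ := add_left_cancel (h1.symm.trans h2)
  have h5 : τ - t₁ ≠ 0 := (sub_pos.2 h3).ne'
  exact smul_right_injective _ h5 h4

end IsSwitch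

end

section

variable {v : EuclideanSpace ℝ (Fin m) → EuclideanSpace ℝ (Fin m)}

/-! ### Solutions and Euler iterates near one switching hyperplane -/

namespace IsSwitch

variable {z n v₁ v₂ : EuclideanSpace ℝ (Fin m)} {r γ : ℝ} {T : ℝ}
  {x : ℝ → EuclideanSpace ℝ (Fin m)} {a b : ℝ}

/-- A side whose velocity does not point away from the hyperplane cannot be entered: here a solution
on the right, or on the hyperplane, does not get to the left. -/
lemma stays_right (h : IsSwitch v z r n γ v₁ v₂) (hx : IsFilippovSolution v T x) (ha : 0 ≤ a)
    (hab : a ≤ b) (hb : b ≤ T) (hball : ∀ t ∈ Icc a b, x t ∈ Metric.ball z r)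
    (hα : 0 ≤ inner ℝ n v₁) (hγ : γ ≤ inner ℝ n (x a)) : γ ≤ inner ℝ n (x b) := by
  by_contra! hlt
  have hcont : ContinuousOn (fun t => (inner ℝ n (x t) : ℝ)) (Icc a b) :=
    continuousOn_const.inner ((IsInclusionSolution.continuousOn hx).mono (Icc_subset_Icc ha hb))
  set S := {t ∈ Icc a b | γ ≤ inner ℝ n (x t)} with hS
  have hSc : IsCompact S := isCompact_Icc.of_isClosed_subset
    (isClosed_Icc.isClosed_le continuousOn_const hcont) (sep_subset _ _)
  obtain ⟨s, ⟨hs, hsγ⟩, hmax⟩ := hSc.exists_isGreatest ⟨a, ⟨le_rfl, hab⟩, hγ⟩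
  have hsol := IsInclusionSolution.sub_eq hx (ha.trans hs.1) hs.2 hb v₁ fun t ht w hw => by
    have htI : t ∈ Icc a b := ⟨hs.1.trans ht.1.le, ht.2.le⟩
    refine h.eq_of_mem_filippovSet (hball t htI) ?_ hw
    by_contra! hge
    exact absurd (hmax ⟨htI, hge⟩) (not_le.2 ht.1)
  have e : (inner ℝ n (x b) : ℝ) = inner ℝ n (x s) + (b - s) * inner ℝ n v₁ := by
    rw [← inner_smul_right, ← inner_add_right, ← hsol]; congr 1; abel
  nlinarith [hs.2]

/-- A solution that moves away from the hyperplane, or parallel to it, never meets it. -/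
lemma sub_eq_of_moves_away (h : IsSwitch v z r n γ v₁ v₂) (hx : IsFilippovSolution v T x)
    (ha : 0 ≤ a) (hab : a ≤ b) (hb : b ≤ T) (hball : ∀ t ∈ Icc a b, x t ∈ Metric.ball z r)
    (hα : inner ℝ n v₁ ≤ 0) (hγ : inner ℝ n (x a) < γ) : x b - x a = (b - a) • v₁ := by
  have hcont : ContinuousOn (fun t => (inner ℝ n (x t) : ℝ)) (Icc a b) :=
    continuousOn_const.inner ((IsInclusionSolution.continuousOn hx).mono (Icc_subset_Icc ha hb))
  have hlt : ∀ t ∈ Icc a b, inner ℝ n (x t) < γ := by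
    by_contra! hcon
    obtain ⟨t₀, ht₀, hge⟩ := hcon
    set S := {t ∈ Icc a b | γ ≤ inner ℝ n (x t)} with hS
    have hSc : IsCompact S := isCompact_Icc.of_isClosed_subset
      (isClosed_Icc.isClosed_le continuousOn_const hcont) (sep_subset _ _)
    obtain ⟨s, ⟨hs, hsγ⟩, hmin⟩ := hSc.exists_isLeast ⟨t₀, ht₀, hge⟩
    have hsol := IsInclusionSolution.sub_eq hx ha hs.1 (hs.2.trans hb) v₁ fun t ht w hw => by
      have htI : t ∈ Icc a b := ⟨ht.1.le, ht.2.le.trans hs.2⟩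
      refine h.eq_of_mem_filippovSet (hball t htI) ?_ hw
      by_contra! hge
      exact absurd (hmin ⟨htI, hge⟩) (not_le.2 ht.2)
    have e : (inner ℝ n (x s) : ℝ) = inner ℝ n (x a) + (s - a) * inner ℝ n v₁ := by
      rw [← inner_smul_right, ← inner_add_right, ← hsol]; congr 1; abel
    nlinarith [hs.1]
  exact IsInclusionSolution.sub_eq hx ha hab hb v₁ fun t ht w hw =>
    h.eq_of_mem_filippovSet (hball t (Ioo_subset_Icc_self ht)) (hlt t (Ioo_subset_Icc_self ht)) hw

/-- If the velocity on the left points towards the hyperplane, motion before reaching the hyperplane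
is straight. -/
lemma sub_eq_left (h : IsSwitch v z r n γ v₁ v₂) (hx : IsFilippovSolution v T x)
    (ha : 0 ≤ a) (hab : a ≤ b) (hb : b ≤ T) (hball : ∀ t ∈ Icc a b, x t ∈ Metric.ball z r)
    (hα : 0 ≤ inner ℝ n v₁) (hγ : inner ℝ n (x b) < γ) : x b - x a = (b - a) • v₁ := by
  refine IsInclusionSolution.sub_eq hx ha hab hb v₁ fun t ht w hw => ?_
  refine h.eq_of_mem_filippovSet (hball t (Ioo_subset_Icc_self ht)) ?_ hw
  by_contra! hge
  have := h.stays_right hx (ha.trans ht.1.le) ht.2.le hb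
    (fun s hs => hball s ⟨ht.1.le.trans hs.1, hs.2⟩) hα hge
  linarith

lemma sub_eq_right (h : IsSwitch v z r n γ v₁ v₂) (hx : IsFilippovSolution v T x)
    (ha : 0 ≤ a) (hab : a ≤ b) (hb : b ≤ T) (hball : ∀ t ∈ Icc a b, x t ∈ Metric.ball z r)
    (hβ : inner ℝ n v₂ ≤ 0) (hγ : γ < inner ℝ n (x b)) : x b - x a = (b - a) • v₂ :=
  h.symm.sub_eq_left hx ha hab hb hball (by rw [inner_neg_left]; linarith)
    (by rw [inner_neg_left]; linarith)

variable {X : ℕ → EuclideanSpace ℝ (Fin m)} {ε : ℝ} {k₁ : ℕ}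

/-- One step of the scalar comparison at an attracting hyperplane: the Euler and the exact normal
coordinates `u`, `y` become `u'`, `y'`, with increments between `ε β` and `ε α`; off the hyperplane
the rates are `α` on the left and `β` on the right. -/
lemma abs_sub_le_of_attracting {α β ε μ u u' y y' : ℝ}
    (hαμ : ε * α ≤ μ) (hβμ : -(ε * β) ≤ μ) (huy : |u - y| ≤ μ)
    (hu : (u ≤ 0 ∧ u' = u + ε * α) ∨ (0 ≤ u ∧ u' = u + ε * β))
    (hyα : y' ≤ y + ε * α) (hyβ : y + ε * β ≤ y')
    (hyl : y' < 0 → y' = y + ε * α) (hyr : 0 < y' → y' = y + ε * β) : |u' - y'| ≤ μ := by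
  rw [abs_le] at huy ⊢
  rcases hu with ⟨hu, rfl⟩ | ⟨hu, rfl⟩
  · refine ⟨by linarith, ?_⟩
    rcases lt_or_ge y' 0 with h0 | h0
    · linarith [hyl h0]
    · linarith
  · refine ⟨?_, by linarith⟩
    rcases lt_or_ge 0 y' with h0 | h0
    · linarith [hyr h0]
    · linarith

/-- Error propagation at an attracting hyperplane. The component of the motion along the sliding
velocity is reproduced exactly: with `d = (v₁ - v₂) / ⟪n, v₁ - v₂⟫`, the map `w ↦ w - ⟪n, w⟫ d` takes the
same value on `v₁` and `v₂`. Only the normal coordinate carries an error, and it contracts. -/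
lemma error_le_of_attracting (h : IsSwitch v z r n γ v₁ v₂) (hx : IsFilippovSolution v T x)
    {M κ : ℝ} (hM₁ : ‖v₁‖ ≤ M) (hM₂ : ‖v₂‖ ≤ M) (hκ : 0 < κ) (hε : 0 < ε)
    (ha : 0 ≤ a) (hT : a + k₁ * ε ≤ T)
    (hball : ∀ t ∈ Icc a (a + k₁ * ε), x t ∈ Metric.ball z r)
    (hX : ∀ k < k₁, X k ∈ Metric.ball z r) (hXs : ∀ k < k₁, X (k + 1) = X k + ε • v (X k))
    (hα : κ ≤ inner ℝ n v₁) (hβ : inner ℝ n v₂ ≤ 0) :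
    ∀ k ≤ k₁, ‖X k - x (a + k * ε)‖ ≤
      (1 + 2 * (2 * M / κ) + 2 * M / κ * M) * (‖X 0 - x a‖ + ε) := by
  set α : ℝ := inner ℝ n v₁ with hαdef
  set β : ℝ := inner ℝ n v₂ with hβdef
  have hM0 : 0 ≤ M := (norm_nonneg _).trans hM₁
  have hαβ : 0 < α - β := by linarith
  set d : 𝔼 := (α - β)⁻¹ • (v₁ - v₂) with hd
  have hdn : ‖d‖ ≤ 2 * M / κ := by
    rw [hd, norm_smul, norm_inv, Real.norm_eq_abs, abs_of_pos hαβ, inv_mul_eq_div]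
    have : ‖v₁ - v₂‖ ≤ 2 * M := (norm_sub_le _ _).trans (by linarith)
    exact div_le_div₀ (by linarith) this hκ (by linarith)
  have hle_norm : ∀ w : 𝔼, |(inner ℝ n w : ℝ)| ≤ ‖w‖ := fun w => by
    simpa [h.norm_eq] using abs_real_inner_le_norm n w
  have hαM : α ≤ M := (le_abs_self _).trans ((hle_norm v₁).trans hM₁)
  have hβM : -β ≤ M := (neg_le_abs _).trans ((hle_norm v₂).trans hM₂)
  -- The linear map that forgets the direction of the jump `v₁ - v₂`.
  set l : 𝔼 →L[ℝ] 𝔼 := ContinuousLinearMap.id ℝ 𝔼 - (innerSL ℝ n).smulRight d with hl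
  have hlw : ∀ w : 𝔼, l w = w - (inner ℝ n w : ℝ) • d := fun w => by simp [hl]
  have hl12 : l v₂ = l v₁ := by
    have e : v₁ - v₂ = (α - β) • d := by rw [hd, smul_inv_smul₀ hαβ.ne']
    rw [hlw, hlw, ← hαdef, ← hβdef, ← sub_eq_zero]
    have : v₂ - β • d - (v₁ - α • d) = (α - β) • d - (v₁ - v₂) := by rw [sub_smul]; abel
    rw [this, e, sub_self]
  have hlseg : ∀ w ∈ segment ℝ v₁ v₂, l w = l v₁ := by
    rintro w ⟨p, q, -, -, hpq, rfl⟩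
    rw [map_add, map_smul, map_smul, hl12, ← add_smul, hpq, one_smul]
  have hnseg : ∀ w ∈ segment ℝ v₁ v₂, β ≤ inner ℝ n w ∧ inner ℝ n w ≤ α := by
    rintro w ⟨p, q, hp, hq, hpq, rfl⟩
    rw [inner_add_right, inner_smul_right, inner_smul_right, ← hαdef, ← hβdef]
    obtain rfl : p = 1 - q := by linarith
    constructor <;> nlinarith
  have hgrid : ∀ k ≤ k₁, a + k * ε ∈ Icc a (a + k₁ * ε) := fun k hk =>
    ⟨by have : (0 : ℝ) ≤ k * ε := by positivity
        linarith, by gcongr⟩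
  set μ : ℝ := ‖X 0 - x a‖ + M * ε with hμ
  have main : ∀ k ≤ k₁, l (X k - x (a + k * ε)) = l (X 0 - x a) ∧
      |(inner ℝ n (X k) - γ) - (inner ℝ n (x (a + k * ε)) - γ)| ≤ μ := by
    intro k
    induction k with
    | zero =>
      intro _
      simp only [Nat.cast_zero, zero_mul, add_zero, true_and, sub_sub_sub_cancel_right]
      rw [← inner_sub_right]
      have := hle_norm (X 0 - x a)
      have : 0 ≤ M * ε := by positivity
      linarith
    | succ k ih =>
      intro hk
      obtain ⟨ih1, ih2⟩ := ih (by omega)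
      have hkI := hgrid k (by omega)
      have hkI' := hgrid (k + 1) hk
      set s := a + k * ε with hs
      have hs' : a + ((k + 1 : ℕ) : ℝ) * ε = s + ε := by rw [hs]; push_cast; ring
      rw [hs'] at hkI' ⊢
      have hs0 : 0 ≤ s := ha.trans hkI.1
      have hsε : s ≤ s + ε := by linarith
      have hsT : s + ε ≤ T := hkI'.2.trans hT
      have hb : ∀ t ∈ Icc s (s + ε), x t ∈ Metric.ball z r := fun t ht =>
        hball t ⟨hkI.1.trans ht.1, ht.2.trans hkI'.2⟩
      have hseg : ∀ t ∈ Ioo s (s + ε), ∀ w ∈ filippovSet v (x t), w ∈ segment ℝ v₁ v₂ :=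
        fun t ht w hw => h.mem_segment_of_mem_filippovSet (hb t (Ioo_subset_Icc_self ht)) hw
      have hXk := hX k (by omega)
      have hvX : v (X k) ∈ segment ℝ v₁ v₂ := by
        rcases h.either _ hXk with e | e <;> rw [e]
        exacts [left_mem_segment ℝ v₁ v₂, right_mem_segment ℝ v₁ v₂]
      rw [hXs k (by omega)]
      constructor
      · have e1 := IsInclusionSolution.map_sub_eq hx hs0 hsε hsT l (l v₁)
          fun t ht w hw => hlseg w (hseg t ht w hw)
        have : X k + ε • v (X k) - x (s + ε) =
            (X k - x s) + ε • v (X k) - (x (s + ε) - x s) := by abel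
        rw [this, map_sub, map_add, map_smul, e1, hlseg _ hvX, add_sub_cancel_left,
          add_sub_cancel_right, ih1]
      · have e1 := IsInclusionSolution.inner_sub_le hx hs0 hsε hsT n α
          fun t ht w hw => (hnseg w (hseg t ht w hw)).2
        have e2 := IsInclusionSolution.inner_sub_le hx hs0 hsε hsT (-n) (-β)
          fun t ht w hw => by
            rw [inner_neg_left]; linarith [(hnseg w (hseg t ht w hw)).1]
        rw [inner_neg_left, inner_sub_right] at e2
        rw [inner_sub_right] at e1
        have hμ1 : ε * M ≤ μ := by rw [hμ]; linarith [norm_nonneg (X 0 - x a)]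
        refine abs_sub_le_of_attracting (ε := ε) (α := α) (β := β) ?_ ?_ ih2 ?_
          (by linarith) (by linarith) ?_ ?_
        · exact (mul_le_mul_of_nonneg_left hαM hε.le).trans hμ1
        · have := mul_le_mul_of_nonneg_left hβM hε.le
          linarith
        · rw [inner_add_right, inner_smul_right]
          rcases lt_trichotomy (inner ℝ n (X k) : ℝ) γ with hlt | heq | hgt
          · left
            rw [h.left _ hXk hlt]
            exact ⟨by linarith, by ring⟩
          · rcases h.either _ hXk with e | e
            · left; rw [e]; exact ⟨by linarith, by ring⟩
            · right; rw [e]; exact ⟨by linarith, by ring⟩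
          · right
            rw [h.right _ hXk hgt]
            exact ⟨by linarith, by ring⟩
        · intro hneg
          have := congrArg (fun w => (inner ℝ n w : ℝ))
            (h.sub_eq_left hx hs0 hsε hsT hb (by linarith) (by linarith))
          simp only [inner_sub_right, inner_smul_right] at this
          linarith
        · intro hpos
          have := congrArg (fun w => (inner ℝ n w : ℝ))
            (h.sub_eq_right hx hs0 hsε hsT hb hβ (by linarith))
          simp only [inner_sub_right, inner_smul_right] at this
          linarith
  intro k hk
  obtain ⟨h1, h2⟩ := main k hk
  rw [sub_sub_sub_cancel_right, ← inner_sub_right] at h2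
  set e := X k - x (a + k * ε) with he
  set e₀ := X 0 - x a with he₀
  have hD : 0 ≤ 2 * M / κ := by positivity
  have e1 : e = e₀ - (inner ℝ n e₀ : ℝ) • d + (inner ℝ n e : ℝ) • d := by
    rw [← hlw, ← h1, hlw, sub_add_cancel]
  have n1 : ‖(inner ℝ n e₀ : ℝ) • d‖ ≤ ‖e₀‖ * (2 * M / κ) := by
    rw [norm_smul]
    exact mul_le_mul (hle_norm e₀) hdn (norm_nonneg _) (norm_nonneg _)
  have n2 : ‖(inner ℝ n e : ℝ) • d‖ ≤ μ * (2 * M / κ) := by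
    rw [norm_smul]
    exact mul_le_mul h2 hdn (norm_nonneg _) ((abs_nonneg _).trans h2)
  calc ‖e‖ = ‖e₀ - (inner ℝ n e₀ : ℝ) • d + (inner ℝ n e : ℝ) • d‖ := by rw [← e1]
    _ ≤ ‖e₀‖ + ‖e₀‖ * (2 * M / κ) + μ * (2 * M / κ) := by
      refine (norm_add_le _ _).trans (add_le_add ((norm_sub_le _ _).trans ?_) n2)
      linarith
    _ ≤ _ := by
      rw [hμ]
      have h3 : 0 ≤ ‖e₀‖ := norm_nonneg _
      have h4 : 0 ≤ 2 * M / κ * M * ‖e₀‖ := by positivity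
      have h5 : 0 ≤ 2 * M / κ * ε := by positivity
      nlinarith

/-- The change of variables that straightens a crossed hyperplane: in the new coordinate a solution
moves with the velocity `v₂` of the right side throughout. Here `α = ⟪n, v₁⟫`. -/
def straighten (n : 𝔼) (γ α : ℝ) (j : 𝔼) (y : 𝔼) : 𝔼 :=
  y + (min (inner ℝ n y - γ) 0 / α) • j

lemma norm_min_smul_sub_le {n j y y' : 𝔼} {γ α κ D : ℝ} (hn : ‖n‖ = 1) (hκ : 0 < κ) (hα : κ ≤ α)
    (hj : ‖j‖ ≤ D) :
    ‖(min (inner ℝ n y - γ) 0 / α) • j - (min (inner ℝ n y' - γ) 0 / α) • j‖ ≤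
      D / κ * ‖y - y'‖ := by
  have hα0 : 0 < α := hκ.trans_le hα
  have hD : 0 ≤ D := (norm_nonneg _).trans hj
  rw [← sub_smul, norm_smul, ← sub_div, Real.norm_eq_abs, abs_div, abs_of_pos hα0]
  have h1 : |min (inner ℝ n y - γ) 0 - min (inner ℝ n y' - γ) 0| ≤ ‖y - y'‖ := by
    refine (abs_min_sub_min_le_max _ _ _ _).trans ?_
    have := abs_real_inner_le_norm n (y - y')
    rw [hn, one_mul, inner_sub_right] at this
    simpa using this
  calc _ ≤ ‖y - y'‖ / κ * D := by gcongr
    _ = _ := by ring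

lemma norm_straighten_sub_le {n j y y' : 𝔼} {γ α κ D : ℝ} (hn : ‖n‖ = 1) (hκ : 0 < κ) (hα : κ ≤ α)
    (hj : ‖j‖ ≤ D) :
    ‖straighten n γ α j y - straighten n γ α j y'‖ ≤ (1 + D / κ) * ‖y - y'‖ := by
  have := norm_min_smul_sub_le (y := y) (y' := y') (γ := γ) hn hκ hα hj
  rw [straighten, straighten, add_sub_add_comm]
  refine (norm_add_le _ _).trans ?_
  linarith

/-- The inverse of the straightening map is of the same form. -/
lemma straighten_straighten {n j : 𝔼} {γ α β : ℝ} (hα : 0 < α) (hβ : 0 < β)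
    (hj : inner ℝ n j = β - α) (y : 𝔼) :
    straighten n γ β (-j) (straighten n γ α j y) = y := by
  have key : min (inner ℝ n (straighten n γ α j y) - γ) 0 / β = min (inner ℝ n y - γ) 0 / α := by
    rw [straighten, inner_add_right, inner_smul_right, hj]
    rcases le_total (inner ℝ n y - γ : ℝ) 0 with h | h
    · rw [min_eq_left h]
      have e : (inner ℝ n y + (inner ℝ n y - γ) / α * (β - α) - γ : ℝ) =
          (inner ℝ n y - γ) * (β / α) := by field_simp; ring
      rw [e, min_eq_left (mul_nonpos_of_nonpos_of_nonneg h (by positivity))]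
      field_simp
    · rw [min_eq_right h, zero_div, zero_mul, add_zero, min_eq_right h, zero_div]
  conv_lhs => rw [straighten, key]
  rw [straighten, smul_neg, add_neg_cancel_right]

lemma straighten_of_le {n j y : 𝔼} {γ α : ℝ} (h : inner ℝ n y ≤ γ) :
    straighten n γ α j y = y + ((inner ℝ n y - γ) / α) • j := by
  rw [straighten, min_eq_left (by linarith)]

lemma straighten_of_ge {n j y : 𝔼} {γ α : ℝ} (h : γ ≤ inner ℝ n y) :
    straighten n γ α j y = y := by
  rw [straighten, min_eq_right (by linarith), zero_div, zero_smul, add_zero]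

lemma straighten_solution (h : IsSwitch v z r n γ v₁ v₂) (hx : IsFilippovSolution v T x)
    (ha : 0 ≤ a) (hab : a ≤ b) (hb : b ≤ T) (hball : ∀ t ∈ Icc a b, x t ∈ Metric.ball z r)
    (hα : 0 < inner ℝ n v₁) (hβ : 0 < inner ℝ n v₂) :
    straighten n γ (inner ℝ n v₁) (v₂ - v₁) (x b) -
      straighten n γ (inner ℝ n v₁) (v₂ - v₁) (x a) = (b - a) • v₂ := by
  have hcont : ContinuousOn (fun t => (inner ℝ n (x t) : ℝ)) (Icc a b) :=
    continuousOn_const.inner ((IsInclusionSolution.continuousOn hx).mono (Icc_subset_Icc ha hb))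
  -- On each side of the hyperplane the motion is straight.
  have hleft : ∀ s ∈ Icc a b, ∀ t ∈ Icc a b, s ≤ t → inner ℝ n (x t) ≤ γ →
      straighten n γ (inner ℝ n v₁) (v₂ - v₁) (x t) -
        straighten n γ (inner ℝ n v₁) (v₂ - v₁) (x s) = (t - s) • v₂ := by
    intro s hs t ht hst hle
    have hlt : ∀ q ∈ Ico s t, inner ℝ n (x q) < γ := by
      intro q hq
      by_contra! hge
      have hqI : ∀ p ∈ Icc q t, p ∈ Icc a b := fun p hp =>
        ⟨hs.1.trans (hq.1.trans hp.1), hp.2.trans ht.2⟩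
      have hge' : ∀ p ∈ Icc q t, γ ≤ inner ℝ n (x p) := fun p hp =>
        h.stays_right hx (ha.trans (hs.1.trans hq.1)) hp.1 ((hqI p hp).2.trans hb)
          (fun p' hp' => hball p' (hqI p' ⟨hp'.1, hp'.2.trans hp.2⟩)) hα.le hge
      have hpos : 0 < min (inner ℝ n v₁ : ℝ) (inner ℝ n v₂) := lt_min hα hβ
      have := IsInclusionSolution.inner_sub_le hx (ha.trans (hs.1.trans hq.1)) hq.2.le
        (ht.2.trans hb) (-n) (-min (inner ℝ n v₁ : ℝ) (inner ℝ n v₂)) fun p hp w hw => by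
          obtain ⟨c, c', hc, hc', hcc, rfl⟩ := h.mem_segment_of_mem_filippovSet
            (hball p (hqI p (Ioo_subset_Icc_self hp))) hw
          rw [inner_neg_left, inner_add_right, inner_smul_right, inner_smul_right]
          have m1 := mul_le_mul_of_nonneg_left (min_le_left (inner ℝ n v₁ : ℝ) (inner ℝ n v₂)) hc
          have m2 := mul_le_mul_of_nonneg_left (min_le_right (inner ℝ n v₁ : ℝ) (inner ℝ n v₂)) hc'
          obtain rfl : c = 1 - c' := by linarith
          linarith
      rw [inner_neg_left, inner_sub_right] at this
      nlinarith [hq.2]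
    have hsol := IsInclusionSolution.sub_eq hx (ha.trans hs.1) hst (ht.2.trans hb) v₁
      fun q hq w hw => h.eq_of_mem_filippovSet
        (hball q ⟨hs.1.trans hq.1.le, hq.2.le.trans ht.2⟩) (hlt q ⟨hq.1.le, hq.2⟩) hw
    have hsle : inner ℝ n (x s) ≤ γ := by
      rcases hst.eq_or_lt with rfl | hst'
      · exact hle
      · exact (hlt s ⟨le_rfl, hst'⟩).le
    have hin : (inner ℝ n (x t) : ℝ) - inner ℝ n (x s) = (t - s) * inner ℝ n v₁ := by
      rw [← inner_sub_right, hsol, inner_smul_right]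
    rw [straighten_of_le hle, straighten_of_le hsle, add_sub_add_comm, hsol, ← sub_smul, ← sub_div,
      sub_sub_sub_cancel_right, hin, mul_div_cancel_right₀ _ hα.ne', ← smul_add,
      add_sub_cancel]
  have hright : ∀ s ∈ Icc a b, γ ≤ inner ℝ n (x s) →
      straighten n γ (inner ℝ n v₁) (v₂ - v₁) (x b) -
        straighten n γ (inner ℝ n v₁) (v₂ - v₁) (x s) = (b - s) • v₂ := by
    intro s hs hge
    have hge' : ∀ p ∈ Icc s b, γ ≤ inner ℝ n (x p) := fun p hp =>
      h.stays_right hx (ha.trans hs.1) hp.1 (hp.2.trans hb)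
        (fun p' hp' => hball p' ⟨hs.1.trans hp'.1, hp'.2.trans hp.2⟩) hα.le hge
    rw [straighten_of_ge hge, straighten_of_ge (hge' b ⟨hs.2, le_rfl⟩)]
    refine IsInclusionSolution.sub_eq hx (ha.trans hs.1) hs.2 hb v₂ fun q hq w hw => ?_
    refine h.symm.eq_of_mem_filippovSet (hball q ⟨hs.1.trans hq.1.le, hq.2.le⟩) ?_ hw
    rw [inner_neg_left, neg_lt_neg_iff]
    by_contra! hle
    -- A solution on the hyperplane at time `q` would have been strictly to the left before `q`.
    have e1 := hleft s hs q ⟨hs.1.trans hq.1.le, hq.2.le⟩ hq.1.le hle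
    have hqge := hge' q (Ioo_subset_Icc_self hq)
    rw [straighten_of_ge hqge, straighten_of_ge hge] at e1
    have e2 := congrArg (fun w => (inner ℝ n w : ℝ)) e1
    simp only [inner_sub_right, inner_smul_right] at e2
    have := mul_pos (sub_pos.2 hq.1) hβ
    linarith
  rcases le_total (inner ℝ n (x b) : ℝ) γ with hle | hge
  · exact hleft a ⟨le_rfl, hab⟩ b ⟨hab, le_rfl⟩ hab hle
  rcases le_total γ (inner ℝ n (x a) : ℝ) with hge' | hle'
  · exact hright a ⟨le_rfl, hab⟩ hge'
  · obtain ⟨s, hs, hsγ⟩ := intermediate_value_Icc hab hcont ⟨hle', hge⟩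
    have hsγ' : (inner ℝ n (x s) : ℝ) = γ := hsγ
    have e1 := hleft a ⟨le_rfl, hab⟩ s hs hs.1 hsγ'.le
    have e2 := hright s hs hsγ'.ge
    rw [← sub_add_sub_cancel _ (straighten n γ (inner ℝ n v₁) (v₂ - v₁) (x s)), e1, e2, ← add_smul]
    congr 1; ring

/-- Error propagation at a hyperplane that is crossed from left to right. In the straightened
coordinate Euler's method is exact except in the single step that crosses the hyperplane. -/
lemma error_le_of_crossing (h : IsSwitch v z r n γ v₁ v₂) (hx : IsFilippovSolution v T x)
    {M κ : ℝ} (hM₁ : ‖v₁‖ ≤ M) (hM₂ : ‖v₂‖ ≤ M) (hκ : 0 < κ) (hε : 0 < ε)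
    (ha : 0 ≤ a) (hT : a + k₁ * ε ≤ T)
    (hball : ∀ t ∈ Icc a (a + k₁ * ε), x t ∈ Metric.ball z r)
    (hX : ∀ k < k₁, X k ∈ Metric.ball z r) (hXs : ∀ k < k₁, X (k + 1) = X k + ε • v (X k))
    (hα : κ ≤ inner ℝ n v₁) (hβ : κ ≤ inner ℝ n v₂) :
    ∀ k ≤ k₁, ‖X k - x (a + k * ε)‖ ≤
      (1 + 2 * M / κ) * (1 + 2 * M / κ + 2 * M) * (‖X 0 - x a‖ + ε) := by
  set α : ℝ := inner ℝ n v₁ with hαdef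
  set β : ℝ := inner ℝ n v₂ with hβdef
  have hα0 : 0 < α := hκ.trans_le hα
  have hβ0 : 0 < β := hκ.trans_le hβ
  have hM0 : 0 ≤ M := (norm_nonneg _).trans hM₁
  set j : 𝔼 := v₂ - v₁ with hj
  have hjn : ‖j‖ ≤ 2 * M := (norm_sub_le _ _).trans (by linarith)
  have hjin : inner ℝ n j = β - α := by rw [hj, inner_sub_right]
  set ψ : 𝔼 → 𝔼 := straighten n γ α j with hψ
  have hgrid : ∀ k ≤ k₁, a + k * ε ∈ Icc a (a + k₁ * ε) := fun k hk =>
    ⟨by have : (0 : ℝ) ≤ k * ε := by positivity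
        linarith, by gcongr⟩
  have hψx : ∀ k ≤ k₁, ψ (x (a + k * ε)) = ψ (x a) + (k * ε) • v₂ := by
    intro k hk
    have hkI := hgrid k hk
    have := h.straighten_solution hx ha hkI.1 (hkI.2.trans hT)
      (fun t ht => hball t ⟨ht.1, ht.2.trans hkI.2⟩) hα0 hβ0
    rw [add_sub_cancel_left] at this
    rw [← this]
    exact (add_sub_cancel _ _).symm
  have hstepL : ∀ k < k₁, inner ℝ n (X k) ≤ γ → v (X k) = v₁ →
      (inner ℝ n (X (k + 1)) ≤ γ → ψ (X (k + 1)) = ψ (X k) + ε • v₂) ∧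
      (γ ≤ inner ℝ n (X (k + 1)) → ‖ψ (X (k + 1)) - (ψ (X k) + ε • v₂)‖ ≤ 2 * M * ε) := by
    intro k hk hle hv
    have hin : (inner ℝ n (X (k + 1)) : ℝ) = inner ℝ n (X k) + ε * α := by
      rw [hXs k hk, hv, inner_add_right, inner_smul_right]
    have hc : (inner ℝ n (X (k + 1)) - γ) / α = (inner ℝ n (X k) - γ) / α + ε := by
      rw [hin]; field_simp; ring
    have e : ψ (X k) + ε • v₂ = X (k + 1) + ((inner ℝ n (X (k + 1)) - γ) / α) • j := by
      rw [hc, hψ, straighten_of_le hle, hXs k hk, hv, add_smul, hj, smul_sub ε]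
      abel
    constructor
    · intro hle'
      rw [e, hψ, straighten_of_le hle']
    · intro hge
      rw [e, hψ, straighten_of_ge hge, sub_add_cancel_left, norm_neg, norm_smul, Real.norm_eq_abs,
        abs_of_nonneg (div_nonneg (by linarith) hα0.le), hc]
      have : (inner ℝ n (X k) - γ) / α ≤ 0 := div_nonpos_of_nonpos_of_nonneg (by linarith) hα0.le
      rw [mul_comm]
      refine mul_le_mul hjn (by linarith) ?_ (by linarith)
      rw [← hc]
      exact div_nonneg (by linarith) hα0.le
  have hstepR : ∀ k < k₁, γ ≤ inner ℝ n (X k) → v (X k) = v₂ →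
      γ < inner ℝ n (X (k + 1)) ∧ ψ (X (k + 1)) = ψ (X k) + ε • v₂ := by
    intro k hk hge hv
    have hgt : γ < inner ℝ n (X (k + 1)) := by
      rw [hXs k hk, hv, inner_add_right, inner_smul_right]
      have := mul_pos hε hβ0
      linarith
    refine ⟨hgt, ?_⟩
    rw [hψ, straighten_of_ge hge, straighten_of_ge hgt.le, hXs k hk, hv]
  set E₀ := ‖ψ (X 0) - ψ (x a)‖ with hE₀
  have hMε : 0 ≤ 2 * M * ε := by positivity
  have main : ∀ k ≤ k₁, ‖ψ (X k) - ψ (x (a + k * ε))‖ ≤ E₀ + 2 * M * ε ∧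
      (inner ℝ n (X k) ≤ γ → ‖ψ (X k) - ψ (x (a + k * ε))‖ ≤ E₀) := by
    intro k
    induction k with
    | zero =>
      intro _
      simp only [Nat.cast_zero, zero_mul, add_zero]
      exact ⟨by linarith, fun _ => le_rfl⟩
    | succ k ih =>
      intro hk
      have hk' : k < k₁ := hk
      obtain ⟨ih1, ih2⟩ := ih hk'.le
      have e0 : ψ (x (a + ((k + 1 : ℕ) : ℝ) * ε)) = ψ (x (a + k * ε)) + ε • v₂ := by
        rw [hψx _ hk, hψx _ hk'.le, add_assoc, ← add_smul]
        push_cast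
        congr 2; ring
      rw [e0]
      have finL : inner ℝ n (X k) ≤ γ → v (X k) = v₁ →
          ‖ψ (X (k + 1)) - (ψ (x (a + k * ε)) + ε • v₂)‖ ≤ E₀ + 2 * M * ε ∧
          (inner ℝ n (X (k + 1)) ≤ γ →
            ‖ψ (X (k + 1)) - (ψ (x (a + k * ε)) + ε • v₂)‖ ≤ E₀) := by
        intro hle hv
        obtain ⟨c1, c2⟩ := hstepL k hk' hle hv
        have c1' : inner ℝ n (X (k + 1)) ≤ γ →
            ‖ψ (X (k + 1)) - (ψ (x (a + k * ε)) + ε • v₂)‖ ≤ E₀ := fun hle' => by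
          rw [c1 hle', add_sub_add_right_eq_sub]; exact ih2 hle
        refine ⟨?_, c1'⟩
        rcases le_total (inner ℝ n (X (k + 1)) : ℝ) γ with hle' | hge'
        · linarith [c1' hle']
        · have e1 := norm_add_le (ψ (X (k + 1)) - (ψ (X k) + ε • v₂))
            (ψ (X k) - ψ (x (a + k * ε)))
          have e2 : ψ (X (k + 1)) - (ψ (X k) + ε • v₂) + (ψ (X k) - ψ (x (a + k * ε))) =
              ψ (X (k + 1)) - (ψ (x (a + k * ε)) + ε • v₂) := by abel
          rw [e2] at e1
          linarith [c2 hge', ih2 hle]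
      have finR : γ ≤ inner ℝ n (X k) → v (X k) = v₂ →
          ‖ψ (X (k + 1)) - (ψ (x (a + k * ε)) + ε • v₂)‖ ≤ E₀ + 2 * M * ε ∧
          (inner ℝ n (X (k + 1)) ≤ γ →
            ‖ψ (X (k + 1)) - (ψ (x (a + k * ε)) + ε • v₂)‖ ≤ E₀) := by
        intro hge hv
        obtain ⟨c1, c2⟩ := hstepR k hk' hge hv
        refine ⟨?_, fun hle' => absurd hle' (not_le.2 c1)⟩
        rw [c2, add_sub_add_right_eq_sub]
        exact ih1
      rcases lt_trichotomy (inner ℝ n (X k) : ℝ) γ with hlt | heq | hgt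
      · exact finL hlt.le (h.left _ (hX k hk') hlt)
      · rcases h.either _ (hX k hk') with e | e
        · exact finL heq.le e
        · exact finR heq.ge e
      · exact finR hgt.le (h.right _ (hX k hk') hgt)
  intro k hk
  have h1 := (main k hk).1
  have h2 : E₀ ≤ (1 + 2 * M / κ) * ‖X 0 - x a‖ := norm_straighten_sub_le h.norm_eq hκ hα hjn
  have h3 := norm_straighten_sub_le (y := ψ (X k)) (y' := ψ (x (a + k * ε))) (γ := γ) h.norm_eq hκ hβ
    (j := -j) (D := 2 * M) (by rwa [norm_neg])
  rw [hψ, straighten_straighten hα0 hβ0 hjin, straighten_straighten hα0 hβ0 hjin, ← hψ] at h3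
  have hD : 0 ≤ 2 * M / κ := by positivity
  refine h3.trans ?_
  rw [mul_assoc]
  refine mul_le_mul_of_nonneg_left (h1.trans ?_) (by linarith)
  have h4 : 0 ≤ 2 * M * ‖X 0 - x a‖ := by positivity
  have h5 : 0 ≤ (1 + 2 * M / κ) * ε := by positivity
  linarith

/-- Where neither velocity points towards the hyperplane, no error arises as long as the initial
error is too small to put the Euler iterates on the other side. -/
lemma sub_eq_of_moves_away_of_lt (h : IsSwitch v z r n γ v₁ v₂) (hx : IsFilippovSolution v T x)
    (hε : 0 < ε) (ha : 0 ≤ a) (hT : a + k₁ * ε ≤ T)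
    (hball : ∀ t ∈ Icc a (a + k₁ * ε), x t ∈ Metric.ball z r)
    (hX : ∀ k < k₁, X k ∈ Metric.ball z r) (hXs : ∀ k < k₁, X (k + 1) = X k + ε • v (X k))
    (hα : inner ℝ n v₁ ≤ 0) (hγ : ‖X 0 - x a‖ < γ - inner ℝ n (x a)) :
    ∀ k ≤ k₁, X k - x (a + k * ε) = X 0 - x a := by
  have hX0 : inner ℝ n (X 0) < γ := by
    have := (le_abs_self _).trans (abs_real_inner_le_norm n (X 0 - x a))
    rw [h.norm_eq, one_mul, inner_sub_right] at this
    linarith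
  have hXk : ∀ k ≤ k₁, X k = X 0 + (k * ε) • v₁ := by
    intro k
    induction k with
    | zero => simp
    | succ k ih =>
      intro hk
      have hk' : k < k₁ := hk
      have ih := ih hk'.le
      have hlt : inner ℝ n (X k) < γ := by
        rw [ih, inner_add_right, inner_smul_right]
        have : (0 : ℝ) ≤ k * ε := by positivity
        nlinarith
      rw [hXs k hk', h.left _ (hX k hk') hlt]
      nth_rw 1 [ih]
      rw [add_assoc, ← add_smul]
      push_cast
      congr 2; ring
  intro k hk
  have hkε : (0 : ℝ) ≤ k * ε := by positivity
  have hkε' : (k : ℝ) * ε ≤ k₁ * ε := by gcongr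
  have := h.sub_eq_of_moves_away hx ha (b := a + k * ε) (by linarith) (by linarith)
    (fun t ht => hball t ⟨ht.1, ht.2.trans (by linarith)⟩) hα
    (by linarith [norm_nonneg (X 0 - x a)])
  rw [add_sub_cancel_left] at this
  rw [hXk k hk, ← this]
  abel

end IsSwitch

/-- Euler's method makes no error where the field is constant. -/
lemma IsFilippovSolution.error_eq_of_const {z w : 𝔼} {r T a ε : ℝ} {k₁ : ℕ} {x : ℝ → 𝔼} {X : ℕ → 𝔼}
    (hx : IsFilippovSolution v T x) (hε : 0 < ε) (hv : ∀ y ∈ Metric.ball z r, v y = w)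
    (ha : 0 ≤ a) (hT : a + k₁ * ε ≤ T)
    (hball : ∀ t ∈ Icc a (a + k₁ * ε), x t ∈ Metric.ball z r)
    (hX : ∀ k < k₁, X k ∈ Metric.ball z r) (hXs : ∀ k < k₁, X (k + 1) = X k + ε • v (X k)) :
    ∀ k ≤ k₁, X k - x (a + k * ε) = X 0 - x a := by
  have hXk : ∀ k ≤ k₁, X k = X 0 + (k * ε) • w := by
    intro k
    induction k with
    | zero => simp
    | succ k ih =>
      intro hk
      have hk' : k < k₁ := hk
      rw [hXs k hk', hv _ (hX k hk'), ih hk'.le, add_assoc, ← add_smul]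
      push_cast
      congr 2; ring
  intro k hk
  have hkε : (0 : ℝ) ≤ k * ε := by positivity
  have hkε' : (k : ℝ) * ε ≤ k₁ * ε := by gcongr
  have := IsInclusionSolution.sub_eq hx ha (b := a + k * ε) (by linarith) (by linarith) w
    fun t ht u hu => by
      have htb := hball t ⟨ht.1.le, ht.2.le.trans (by linarith)⟩
      refine filippovSet_subset (convex_singleton w) isClosed_singleton ?_ hu
      filter_upwards [Metric.isOpen_ball.mem_nhds htb] with y' hy'
      exact hv y' hy'
  rw [add_sub_cancel_left] at this
  rw [hXk k hk, ← this]
  abel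

end

section

variable {ι : Type*} {v : EuclideanSpace ℝ (Fin m) → EuclideanSpace ℝ (Fin m)}
  {lab : EuclideanSpace ℝ (Fin m) → ι} {Q : ι → Set (EuclideanSpace ℝ (Fin m))}
  {vel : ι → EuclideanSpace ℝ (Fin m)}

/-! ### Fields that are constant on convex cells -/

/-- A field that takes the value `vel c` on the points labelled `c`, where the points labelled `c`
lie between the interior of a closed convex cell `Q c` and the cell itself. Cells may have empty
interior; they then consist of points at which a tie between other cells is resolved. -/
structure IsCellField (v : EuclideanSpace ℝ (Fin m) → EuclideanSpace ℝ (Fin m))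
    (lab : EuclideanSpace ℝ (Fin m) → ι) (Q : ι → Set (EuclideanSpace ℝ (Fin m)))
    (vel : ι → EuclideanSpace ℝ (Fin m)) : Prop where
  isClosed : ∀ c, IsClosed (Q c)
  convex : ∀ c, Convex ℝ (Q c)
  mem : ∀ y, y ∈ Q (lab y)
  lab_eq : ∀ c, ∀ y ∈ interior (Q c), lab y = c
  eq_vel : ∀ y, v y = vel (lab y)

/-- Only the labels `c` and `d` occur in the ball `B(z, r)`. -/
def OnlyLabels (lab : EuclideanSpace ℝ (Fin m) → ι) (z : 𝔼) (r : ℝ) (c d : ι) : Prop :=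
  ∀ y ∈ Metric.ball z r, lab y = c ∨ lab y = d

/-- The hyperplane `⟪n, y⟫ = γ` with unit normal `n` separates the cells `c` and `d`, with `c` on
the left. -/
structure Separates (Q : ι → Set (EuclideanSpace ℝ (Fin m))) (c d : ι) (n : 𝔼) (γ : ℝ) : Prop where
  norm_eq : ‖n‖ = 1
  left : ∀ y ∈ Q c, inner ℝ n y ≤ γ
  right : ∀ y ∈ Q d, γ ≤ inner ℝ n y

lemma OnlyLabels.symm {z : 𝔼} {r : ℝ} {c d : ι} (h : OnlyLabels lab z r c d) :
    OnlyLabels lab z r d c := fun y hy => (h y hy).symm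

lemma Separates.symm {c d : ι} {n : 𝔼} {γ : ℝ} (h : Separates Q c d n γ) :
    Separates Q d c (-n) (-γ) where
  norm_eq := by rw [norm_neg, h.norm_eq]
  left y hy := by rw [inner_neg_left]; linarith [h.right y hy]
  right y hy := by rw [inner_neg_left]; linarith [h.left y hy]

namespace IsCellField

lemma exists_separates (hQ : IsCellField v lab Q vel) {c d : ι} (hcd : c ≠ d)
    (hc : (interior (Q c)).Nonempty) (hd : (interior (Q d)).Nonempty) :
    ∃ n γ, Separates Q c d n γ := by
  have hdisj : Disjoint (interior (Q c)) (interior (Q d)) := by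
    rw [Set.disjoint_left]
    intro y hyc hyd
    exact hcd ((hQ.lab_eq c y hyc).symm.trans (hQ.lab_eq d y hyd))
  obtain ⟨f, u, hf1, hf2⟩ := geometric_hahn_banach_open_open (hQ.convex c).interior isOpen_interior
    (hQ.convex d).interior isOpen_interior hdisj
  set n₀ : 𝔼 := (InnerProductSpace.toDual ℝ 𝔼).symm f with hn₀
  have hfn : ∀ y, f y = inner ℝ n₀ y := fun y => by
    rw [hn₀, InnerProductSpace.toDual_symm_apply]
  have hn0 : n₀ ≠ 0 := by
    intro h0
    obtain ⟨y, hy⟩ := hc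
    obtain ⟨y', hy'⟩ := hd
    have h1 := hf1 y hy
    have h2 := hf2 y' hy'
    rw [hfn, h0, inner_zero_left] at h1 h2
    linarith
  have hpos : 0 < ‖n₀‖ := norm_pos_iff.2 hn0
  have hin : ∀ y, (inner ℝ (‖n₀‖⁻¹ • n₀) y : ℝ) = ‖n₀‖⁻¹ * f y := fun y => by
    rw [hfn, inner_smul_left]; rfl
  have hcl : ∀ c, (interior (Q c)).Nonempty → Q c ⊆ closure (interior (Q c)) := fun c hc => by
    rw [(hQ.convex c).closure_interior_eq_closure_of_nonempty_interior hc]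
    exact subset_closure
  refine ⟨‖n₀‖⁻¹ • n₀, ‖n₀‖⁻¹ * u, norm_smul_inv_norm hn0, fun y hy => ?_, fun y hy => ?_⟩
  · rw [hin]
    have : y ∈ {y | f y ≤ u} :=
      closure_minimal (fun y hy => (hf1 y hy).le) (isClosed_le f.continuous continuous_const)
        (hcl c hc hy)
    exact mul_le_mul_of_nonneg_left this (by positivity)
  · rw [hin]
    have : y ∈ {y | u ≤ f y} :=
      closure_minimal (fun y hy => (hf2 y hy).le) (isClosed_le continuous_const f.continuous)
        (hcl d hd hy)
    exact mul_le_mul_of_nonneg_left this (by positivity)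

/-- If a cell with empty interior is one of only two that occur in a ball, the other one fills the
ball. -/
lemma subset_interior_of_empty (hQ : IsCellField v lab Q vel) {z : 𝔼} {r : ℝ} {c d : ι}
    (h : OnlyLabels lab z r c d) (hc : interior (Q c) = ∅) :
    Metric.ball z r ⊆ interior (Q d) := by
  refine interior_maximal (fun y hy => ?_) Metric.isOpen_ball
  by_contra hyd
  have hopen : IsOpen (Metric.ball z r ∩ (Q d)ᶜ) :=
    Metric.isOpen_ball.inter (hQ.isClosed d).isOpen_compl
  have hsub : Metric.ball z r ∩ (Q d)ᶜ ⊆ Q c := by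
    rintro y' ⟨hy', hy'd⟩
    rcases h y' hy' with e | e
    · exact e ▸ hQ.mem y'
    · exact absurd (e ▸ hQ.mem y') hy'd
  have := interior_maximal hsub hopen ⟨hy, hyd⟩
  rw [hc] at this
  exact this

lemma mem_interior_of_lt (hQ : IsCellField v lab Q vel) {z n : 𝔼} {r γ : ℝ} {c d : ι}
    (h : OnlyLabels lab z r c d) (hS : Separates Q c d n γ) {y : 𝔼} (hy : y ∈ Metric.ball z r)
    (hlt : inner ℝ n y < γ) : y ∈ interior (Q c) := by
  refine mem_interior.2 ⟨Metric.ball z r ∩ {y | inner ℝ n y < γ}, ?_,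
    Metric.isOpen_ball.inter (isOpen_lt (by fun_prop) continuous_const), hy, hlt⟩
  rintro y' ⟨hy', hlt'⟩
  rcases h y' hy' with e | e
  · exact e ▸ hQ.mem y'
  · exact absurd (hS.right y' (e ▸ hQ.mem y')) (not_le.2 hlt')

lemma isSwitch (hQ : IsCellField v lab Q vel) {z n : 𝔼} {r γ : ℝ} {c d : ι}
    (h : OnlyLabels lab z r c d) (hS : Separates Q c d n γ) :
    IsSwitch v z r n γ (vel c) (vel d) where
  norm_eq := hS.norm_eq
  left y hy hlt := by rw [hQ.eq_vel, hQ.lab_eq c y (hQ.mem_interior_of_lt h hS hy hlt)]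
  right y hy hlt := by
    rw [hQ.eq_vel, hQ.lab_eq d y (hQ.mem_interior_of_lt h.symm hS.symm hy
      (by rw [inner_neg_left]; linarith))]
  either y hy := by
    rw [hQ.eq_vel]
    exact (h y hy).imp (congrArg vel) (congrArg vel)

lemma mem_of_le (hQ : IsCellField v lab Q vel) {z n : 𝔼} {r γ : ℝ} {c d : ι}
    (h : OnlyLabels lab z r c d) (hS : Separates Q c d n γ) {y : 𝔼} (hy : y ∈ Metric.ball z r)
    (hle : inner ℝ n y ≤ γ) : y ∈ Q c := by
  refine closure_minimal ?_ (hQ.isClosed c) ((hQ.isSwitch h hS).mem_closure_left hy hle)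
  rintro y' ⟨hy', hlt⟩
  exact interior_subset (hQ.mem_interior_of_lt h hS hy' hlt)

/-- Inside the cells, a set that is connected stays in a single cell. -/
lemma subset_interior_of_isPreconnected (hQ : IsCellField v lab Q vel) {S : Set 𝔼}
    (hS : IsPreconnected S) (hsub : ∀ y ∈ S, ∃ c, y ∈ interior (Q c)) {c : ι} {y₀ : 𝔼}
    (hy₀ : y₀ ∈ S) (hc : y₀ ∈ interior (Q c)) : S ⊆ interior (Q c) := by
  refine hS.subset_left_of_subset_union (v := ⋃ d ≠ c, interior (Q d)) isOpen_interior
    (isOpen_biUnion fun _ _ => isOpen_interior) ?_ ?_ ⟨y₀, hy₀, hc⟩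
  · rw [Set.disjoint_left]
    intro y hy hy'
    simp only [mem_iUnion] at hy'
    obtain ⟨d, hdc, hyd⟩ := hy'
    exact hdc ((hQ.lab_eq d y hyd).symm.trans (hQ.lab_eq c y hy))
  · intro y hy
    obtain ⟨d, hd⟩ := hsub y hy
    by_cases hdc : d = c
    · exact Or.inl (hdc ▸ hd)
    · exact Or.inr (mem_biUnion (mem_ofPred.2 hdc) hd)

lemma sub_eq_of_mem_interior (hQ : IsCellField v lab Q vel) {T a b : ℝ} {x : ℝ → 𝔼}
    (hx : IsFilippovSolution v T x) (ha : 0 ≤ a) (hab : a ≤ b) (hb : b ≤ T) {c : ι}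
    (h : ∀ t ∈ Ioo a b, x t ∈ interior (Q c)) : x b - x a = (b - a) • vel c := by
  refine IsInclusionSolution.sub_eq hx ha hab hb _ fun t ht w hw => ?_
  refine filippovSet_subset (convex_singleton (vel c)) isClosed_singleton ?_ hw
  filter_upwards [isOpen_interior.mem_nhds (h t ht)] with y hy
  rw [hQ.eq_vel, hQ.lab_eq c y hy]
  rfl

/-- Euler's method is exact as long as the solution has not left the interior of the first cell. -/
lemma iterates_eq_of_mem_interior (hQ : IsCellField v lab Q vel) {T s ε : ℝ} {x : ℝ → 𝔼}
    (hx : IsFilippovSolution v T x) (hs : s ≤ T) (hε : 0 < ε)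
    (hint : ∀ t ∈ Icc 0 s, ∃ c, x t ∈ interior (Q c)) (k : ℕ) (hk : k * ε ≤ s) :
    iterates v ε (x 0) k = x (k * ε) := by
  have hs0 : 0 ≤ s := le_trans (by positivity) hk
  obtain ⟨c, hc⟩ := hint 0 ⟨le_rfl, hs0⟩
  have hcont : ContinuousOn x (Icc 0 s) :=
    (IsInclusionSolution.continuousOn hx).mono (Icc_subset_Icc_right hs)
  have hsub : x '' Icc 0 s ⊆ interior (Q c) := by
    refine hQ.subset_interior_of_isPreconnected (isPreconnected_Icc.image _ hcont) ?_
      (mem_image_of_mem x ⟨le_rfl, hs0⟩) hc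
    rintro _ ⟨t, ht, rfl⟩
    exact hint t ht
  induction k with
  | zero => simp [iterates]
  | succ k ih =>
    push_cast at hk ⊢
    have hk0 : (0 : ℝ) ≤ k * ε := by positivity
    have hk1 : k * ε ≤ (k + 1) * ε := by nlinarith
    have hmem := hsub (mem_image_of_mem x ⟨hk0, hk1.trans hk⟩)
    have e := hQ.sub_eq_of_mem_interior hx hk0 hk1 (hk.trans hs) (c := c) fun t ht =>
      hsub (mem_image_of_mem x ⟨hk0.trans ht.1.le, ht.2.le.trans hk⟩)
    rw [show ((k + 1) * ε - k * ε : ℝ) = ε by ring] at e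
    rw [iterates, ih (hk1.trans hk), hQ.eq_vel, hQ.lab_eq c _ hmem, ← e, add_sub_cancel]

end IsCellField

/-! ### Uniform constants from finiteness -/

lemma exists_gap {J : Type*} [Finite J] (f : J → ℝ) : ∃ κ > 0, ∀ i, f i = 0 ∨ κ ≤ |f i| := by
  classical
  cases nonempty_fintype J
  by_cases hne : (Finset.univ.filter fun i => f i ≠ 0).Nonempty
  · obtain ⟨i₀, hi₀, hmin⟩ := Finset.exists_min_image _ (fun i => |f i|) hne
    refine ⟨|f i₀|, abs_pos.2 (Finset.mem_filter.1 hi₀).2, fun i => ?_⟩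
    by_cases hi : f i = 0
    · exact Or.inl hi
    · exact Or.inr (hmin i (Finset.mem_filter.2 ⟨Finset.mem_univ _, hi⟩))
  · refine ⟨1, one_pos, fun i => Or.inl ?_⟩
    by_contra hi
    exact hne ⟨i, Finset.mem_filter.2 ⟨Finset.mem_univ _, hi⟩⟩

/-- `N` is a symmetric set of unit normals that suffices to separate the cells, and `κ` bounds from
below the nonzero normal speeds and the squared sines of the angles between nonparallel normals. -/
structure IsGap (Q : ι → Set (EuclideanSpace ℝ (Fin m))) (vel : ι → EuclideanSpace ℝ (Fin m))
    (N : Set (EuclideanSpace ℝ (Fin m))) (κ : ℝ) : Prop where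
  pos : 0 < κ
  neg_mem : ∀ n ∈ N, -n ∈ N
  speed : ∀ n ∈ N, ∀ c, (inner ℝ n (vel c) : ℝ) = 0 ∨ κ ≤ |(inner ℝ n (vel c) : ℝ)|
  angle : ∀ n ∈ N, ∀ n' ∈ N, 1 - (inner ℝ n n' : ℝ) ^ 2 = 0 ∨ κ ≤ |1 - (inner ℝ n n' : ℝ) ^ 2|
  separates : ∀ c d, c ≠ d → (interior (Q c)).Nonempty → (interior (Q d)).Nonempty →
    ∃ n ∈ N, ∃ γ, Separates Q c d n γ

lemma IsCellField.exists_isGap [Finite ι] (hQ : IsCellField v lab Q vel) :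
    ∃ N κ, IsGap Q vel N κ := by
  classical
  have hch : ∀ p : ι × ι, ∃ n : 𝔼, p.1 ≠ p.2 → (interior (Q p.1)).Nonempty →
      (interior (Q p.2)).Nonempty → ∃ γ, Separates Q p.1 p.2 n γ := by
    intro p
    by_cases h : p.1 ≠ p.2 ∧ (interior (Q p.1)).Nonempty ∧ (interior (Q p.2)).Nonempty
    · obtain ⟨n, γ, hS⟩ := hQ.exists_separates h.1 h.2.1 h.2.2
      exact ⟨n, fun _ _ _ => ⟨γ, hS⟩⟩
    · exact ⟨0, fun h1 h2 h3 => absurd ⟨h1, h2, h3⟩ h⟩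
  choose nrm hnrm using hch
  set N : Set 𝔼 := range nrm ∪ range fun p => -nrm p with hN
  have hfin : N.Finite := (finite_range _).union (finite_range _)
  have : Finite N := hfin
  obtain ⟨κ₁, hκ₁, h₁⟩ := exists_gap fun p : N × ι => (inner ℝ (p.1 : 𝔼) (vel p.2) : ℝ)
  obtain ⟨κ₂, hκ₂, h₂⟩ := exists_gap fun p : N × N => 1 - (inner ℝ (p.1 : 𝔼) (p.2 : 𝔼) : ℝ) ^ 2
  refine ⟨N, min κ₁ κ₂, lt_min hκ₁ hκ₂, ?_, ?_, ?_, ?_⟩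
  · rintro n (⟨p, rfl⟩ | ⟨p, rfl⟩)
    · exact Or.inr ⟨p, rfl⟩
    · exact Or.inl ⟨p, (neg_neg _).symm⟩
  · intro n hn c
    exact (h₁ (⟨n, hn⟩, c)).imp id fun h => (min_le_left _ _).trans h
  · intro n hn n' hn'
    exact (h₂ (⟨n, hn⟩, ⟨n', hn'⟩)).imp id fun h => (min_le_right _ _).trans h
  · intro c d hcd hc hd
    obtain ⟨γ, hγ⟩ := hnrm (c, d) hcd hc hd
    exact ⟨_, Or.inl ⟨(c, d), rfl⟩, γ, hγ⟩

end

section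

variable {ι : Type*} {v : EuclideanSpace ℝ (Fin m) → EuclideanSpace ℝ (Fin m)}
  {lab : EuclideanSpace ℝ (Fin m) → ι} {Q : ι → Set (EuclideanSpace ℝ (Fin m))}
  {vel : ι → EuclideanSpace ℝ (Fin m)} {N : Set (EuclideanSpace ℝ (Fin m))} {κ : ℝ}

/-! ### Clearance from interfaces that repel or do not attract -/

lemma IsCellField.subset_interior_or_separates (hQ : IsCellField v lab Q vel)
    (hG : IsGap Q vel N κ) {z : 𝔼} {r : ℝ} {c d : ι} (h : OnlyLabels lab z r c d) :
    (∃ e, Metric.ball z r ⊆ interior (Q e)) ∨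
      ∃ n ∈ N, ∃ γ, Separates Q c d n γ := by
  by_cases hcd : c = d
  · subst hcd
    refine Or.inl ⟨c, interior_maximal (fun y hy => ?_) Metric.isOpen_ball⟩
    rcases h y hy with e | e <;> exact e ▸ hQ.mem y
  rcases (interior (Q c)).eq_empty_or_nonempty with hc | hc
  · exact Or.inl ⟨d, hQ.subset_interior_of_empty h hc⟩
  rcases (interior (Q d)).eq_empty_or_nonempty with hd | hd
  · exact Or.inl ⟨c, hQ.subset_interior_of_empty h.symm hd⟩
  exact Or.inr (hG.separates c d hcd hc hd)

/-- The clearance guaranteed by `clearance_le`. -/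
def clearance (κ M r : ℝ) : ℝ := min (r / 2) (min (r * κ / 2) (κ * (r / 2 / M)))

lemma clearance_pos {κ M r : ℝ} (hκ : 0 < κ) (hM : 0 < M) (hr : 0 < r) : 0 < clearance κ M r := by
  unfold clearance; positivity

/-- If the cell on the left contains the half of `B(p, r)` on the left of a hyperplane through `p`,
a separating hyperplane of the same cell is either far from `p` or has the same normal. -/
lemma eq_or_le_of_halfBall_subset {n n' p : 𝔼} {γ r : ℝ} {C : Set 𝔼} (hr : 0 < r)
    (hn : ‖n‖ = 1) (hn' : ‖n'‖ = 1)
    (hangle : 1 - (inner ℝ n n' : ℝ) ^ 2 = 0 ∨ κ ≤ |1 - (inner ℝ n n' : ℝ) ^ 2|)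
    (hhalf : ∀ u : 𝔼, ‖u‖ < r → inner ℝ n' u ≤ 0 → p + u ∈ C) (hC : ∀ y ∈ C, inner ℝ n y ≤ γ) :
    n = n' ∨ min (r / 2) (r * κ / 2) ≤ γ - inner ℝ n p := by
  have hle : ∀ u : 𝔼, ‖u‖ < r → inner ℝ n' u ≤ 0 → inner ℝ n u ≤ γ - inner ℝ n p := by
    intro u hu hu'
    have := hC _ (hhalf u hu hu')
    rw [inner_add_right] at this
    linarith
  have hself : ∀ w : 𝔼, ‖w‖ = 1 → (inner ℝ w w : ℝ) = 1 := fun w hw => by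
    rw [real_inner_self_eq_norm_sq, hw, one_pow]
  have hab : |(inner ℝ n n' : ℝ)| ≤ 1 := by
    simpa [hn, hn'] using abs_real_inner_le_norm n n'
  set ρ : ℝ := inner ℝ n n' with hρ
  rcases hangle with h0 | hκ
  · have hsq : (1 - ρ) * (1 + ρ) = 0 := by linarith
    rcases mul_eq_zero.1 hsq with h1 | h1
    · left
      have h2 : (inner ℝ n n' : ℝ) = 1 := by linarith
      exact (inner_eq_one_iff_of_norm_eq_one hn hn').1 h2
    · right
      -- The normals are opposite: move from `p` straight towards the hyperplane with normal `n`.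
      have hnn : inner ℝ n' n = -1 := by rw [real_inner_comm]; linarith
      have := hle ((r / 2) • n) (by rw [norm_smul, hn, Real.norm_eq_abs, abs_of_pos (by positivity)]
                                    linarith)
        (by rw [inner_smul_right, hnn]; linarith)
      rw [inner_smul_right, hself n hn] at this
      exact (min_le_left _ _).trans (by linarith)
  · right
    have hnonneg : 0 ≤ 1 - ρ ^ 2 := by
      have := abs_le.1 hab
      nlinarith
    rw [abs_of_nonneg hnonneg] at hκ
    -- Move from `p` along the component of `n` parallel to the first hyperplane.
    have hnn : inner ℝ n' n = ρ := by rw [real_inner_comm]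
    have hnorm : ‖n - ρ • n'‖ ≤ 1 := by
      have : ‖n - ρ • n'‖ ^ 2 = 1 - ρ ^ 2 := by
        rw [← real_inner_self_eq_norm_sq, inner_sub_left, inner_sub_right, inner_sub_right,
          inner_smul_left, inner_smul_left, inner_smul_right, inner_smul_right, hself n hn,
          hself n' hn', hnn, ← hρ]
        simp; ring
      nlinarith [norm_nonneg (n - ρ • n')]
    have := hle ((r / 2) • (n - ρ • n'))
      (by rw [norm_smul, Real.norm_eq_abs, abs_of_pos (by positivity)]; nlinarith)
      (by rw [inner_smul_right, inner_sub_right, inner_smul_right, hnn, hself n' hn']; simp)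
    rw [inner_smul_right, inner_sub_right, inner_smul_right, hself n hn, ← hρ] at this
    refine (min_le_right _ _).trans (le_trans ?_ this)
    nlinarith

/-- Going back from a point in the interior of the cell `c` to the last contact `x t₁` with an
interface: the motion since then is straight, and `c` is one of the two cells at `x t₁`. -/
lemma exists_last_contact (hQ : IsCellField v lab Q vel) (hG : IsGap Q vel N κ) {T r : ℝ}
    {x : ℝ → 𝔼} (hx : IsFilippovSolution v T x) (hr : 0 < r)
    (hloc : ∀ t ∈ Icc 0 T, ∃ c d, OnlyLabels lab (x t) r c d) {s : ℝ} (hsT : s < T)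
    {c : ι} (hxs : x s ∈ interior (Q c)) {t₀ : ℝ} (ht₀ : t₀ ∈ Icc 0 s)
    (hout : ∀ e, x t₀ ∉ interior (Q e)) :
    ∃ t₁, 0 ≤ t₁ ∧ t₁ < s ∧ x s - x t₁ = (s - t₁) • vel c ∧ ∃ d, ∃ n ∈ N,
      OnlyLabels lab (x t₁) r c d ∧ Separates Q c d n (inner ℝ n (x t₁)) := by
  have hcont : ContinuousOn x (Icc 0 T) := IsInclusionSolution.continuousOn hx
  have hSc : IsCompact (Icc 0 s ∩ x ⁻¹' (⋃ e, interior (Q e))ᶜ) :=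
    isCompact_Icc.of_isClosed_subset
      ((hcont.mono (Icc_subset_Icc_right hsT.le)).preimage_isClosed_of_isClosed isClosed_Icc
        (isOpen_iUnion fun e => isOpen_interior).isClosed_compl) inter_subset_left
  obtain ⟨t₁, ⟨ht₁, hp⟩, hmax⟩ := hSc.exists_isGreatest ⟨t₀, ht₀, by simpa using hout⟩
  have hp : ∀ e, x t₁ ∉ interior (Q e) := by simpa using hp
  have ht₁s : t₁ < s := lt_of_le_of_ne ht₁.2 fun e => hp c (e ▸ hxs)
  have hin : ∀ t ∈ Ioc t₁ s, x t ∈ interior (Q c) := by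
    have hsub : x '' Ioc t₁ s ⊆ interior (Q c) := by
      refine hQ.subset_interior_of_isPreconnected (isPreconnected_Ioc.image _ (hcont.mono
        fun t ht => ⟨ht₁.1.trans ht.1.le, ht.2.trans hsT.le⟩)) ?_
        (mem_image_of_mem x ⟨ht₁s, le_rfl⟩) hxs
      rintro _ ⟨t, ht, rfl⟩
      by_contra! hno
      exact absurd (hmax ⟨⟨ht₁.1.trans ht.1.le, ht.2⟩, by simpa using hno⟩) (not_le.2 ht.1)
    exact fun t ht => hsub (mem_image_of_mem x ht)
  refine ⟨t₁, ht₁.1, ht₁s, hQ.sub_eq_of_mem_interior hx ht₁.1 ht₁s.le hsT.le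
    fun t ht => hin t ⟨ht.1, ht.2.le⟩, ?_⟩
  have hpball : x t₁ ∈ Metric.ball (x t₁) r := Metric.mem_ball_self hr
  obtain ⟨d, n, hn, γ, hcd, hS⟩ : ∃ d, ∃ n ∈ N, ∃ γ, OnlyLabels lab (x t₁) r c d ∧
      Separates Q c d n γ := by
    obtain ⟨c', d, hcd⟩ := hloc t₁ ⟨ht₁.1, ht₁.2.trans hsT.le⟩
    rcases hQ.subset_interior_or_separates hG hcd with ⟨e, he⟩ | ⟨n, hn, γ, hS⟩
    · exact absurd (he hpball) (hp e)
    · have hev : ∀ᶠ t in 𝓝[>] t₁, x t ∈ Metric.ball (x t₁) r := by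
        have h1 : ContinuousWithinAt x (Ioo t₁ T) t₁ :=
          (hcont t₁ ⟨ht₁.1, ht₁.2.trans hsT.le⟩).mono fun t ht => ⟨ht₁.1.trans ht.1.le, ht.2.le⟩
        have h2 := h1.eventually (Metric.ball_mem_nhds (x t₁) hr)
        rwa [nhdsWithin_Ioo_eq_nhdsGT (ht₁s.trans hsT)] at h2
      obtain ⟨t, ht, htI⟩ := (hev.and (Ioc_mem_nhdsGT ht₁s)).exists
      have hlab := hQ.lab_eq c _ (hin t htI)
      rcases hcd _ ht with e | e
      · obtain rfl : c' = c := e.symm.trans hlab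
        exact ⟨d, n, hn, γ, hcd, hS⟩
      · obtain rfl : d = c := e.symm.trans hlab
        exact ⟨c', -n, hG.neg_mem _ hn, -γ, hcd.symm, hS.symm⟩
  have hγ : inner ℝ n (x t₁) = γ := by
    rcases lt_trichotomy (inner ℝ n (x t₁) : ℝ) γ with h | h | h
    · exact absurd (hQ.mem_interior_of_lt hcd hS hpball h) (hp c)
    · exact h
    · exact absurd (hQ.mem_interior_of_lt hcd.symm hS.symm hpball
        (by rw [inner_neg_left]; linarith)) (hp d)
  exact ⟨d, n, hn, hcd, hγ ▸ hS⟩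

/-- A point near the hyperplane between `c` and `d` is far from any point near which `d` does not
occur. -/
lemma IsCellField.half_le_dist (hQ : IsCellField v lab Q vel) {p y n : 𝔼} {r γ : ℝ} {c d d' : ι}
    (hr : 0 < r) (hcd : OnlyLabels lab y r c d) (hS : Separates Q c d n γ)
    (hcd' : OnlyLabels lab p r c d') (hdd : d' ≠ d) (hy : γ - inner ℝ n y < r / 2) :
    r / 2 ≤ dist y p := by
  by_contra! hnear
  -- A point just beyond the hyperplane is labelled `d`.
  have hdist : dist (y + (r / 2) • n) y = r / 2 := by
    rw [dist_self_add_left, norm_smul, hS.norm_eq, Real.norm_eq_abs, abs_of_nonneg (by linarith),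
      mul_one]
  have hin : γ < inner ℝ n (y + (r / 2) • n) := by
    rw [inner_add_right, inner_smul_right, real_inner_self_eq_norm_sq, hS.norm_eq]
    linarith
  have hmem : y + (r / 2) • n ∈ Metric.ball y r := by
    rw [Metric.mem_ball, hdist]; linarith
  have hlab : lab (y + (r / 2) • n) = d :=
    hQ.lab_eq d _ (hQ.mem_interior_of_lt hcd.symm hS.symm hmem
      (by rw [inner_neg_left]; linarith))
  have hmem' : y + (r / 2) • n ∈ Metric.ball p r := by
    rw [Metric.mem_ball]
    have := dist_triangle (y + (r / 2) • n) y p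
    rw [hdist] at this
    linarith
  rcases hcd' _ hmem' with e | e
  · exact absurd (hS.left _ (e ▸ hQ.mem (y + (r / 2) • n))) (not_le.2 hin)
  · exact hdd (e.symm.trans hlab)

/-- A solution that has met an interface, and now moves away from, or parallel to, a hyperplane
whose other side does not push back, keeps a distance from this hyperplane that is bounded below.

Going back along the straight motion to the point `p` of the last contact with an interface, the
distance does not increase. If the interface at `p` has the same two cells, `p` would lie on the
hyperplane, against uniqueness. Otherwise the second cell is at least `r` away from `p`: either
the two hyperplanes have different normals, and the cell, containing a half-ball at `p`, keeps `p`
away from the second one; or they coincide, and the distance gained since the last contact is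
bounded below. -/
lemma clearance_le (hQ : IsCellField v lab Q vel) (hG : IsGap Q vel N κ) {T M r : ℝ} {x : ℝ → 𝔼}
    (hx : IsUniqueFilippovSolution v T x) (hM : ∀ y, ‖v y‖ ≤ M) (hM0 : 0 < M) (hr : 0 < r)
    (hloc : ∀ t ∈ Icc 0 T, ∃ c d, OnlyLabels lab (x t) r c d) {s : ℝ} (hsT : s < T)
    {c d : ι} (hcd : OnlyLabels lab (x s) r c d) {n : 𝔼} (hn : n ∈ N) {γ : ℝ}
    (hS : Separates Q c d n γ) (hne : vel c ≠ vel d) (hα : inner ℝ n (vel c) ≤ 0)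
    (hβ : 0 ≤ inner ℝ n (vel d)) (hlt : inner ℝ n (x s) < γ) {t₀ : ℝ} (ht₀ : t₀ ∈ Icc 0 s)
    (hout : ∀ e, x t₀ ∉ interior (Q e)) :
    clearance κ M r ≤ γ - inner ℝ n (x s) := by
  by_contra! hcon
  obtain ⟨t₁, ht₁, ht₁s, hline, d', n', hn', hcd', hS'⟩ := exists_last_contact hQ hG hx.1 hr hloc
    hsT (hQ.mem_interior_of_lt hcd hS (Metric.mem_ball_self hr) hlt) ht₀ hout
  have hpball : x t₁ ∈ Metric.ball (x t₁) r := Metric.mem_ball_self hr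
  have hpc : x t₁ ∈ Q c := hQ.mem_of_le hcd' hS' hpball le_rfl
  have hpγ : inner ℝ n (x t₁) ≤ γ := hS.left _ hpc
  have hprog : γ - inner ℝ n (x s) = γ - inner ℝ n (x t₁) - (s - t₁) * inner ℝ n (vel c) := by
    rw [← inner_smul_right, ← hline, inner_sub_right]; ring
  have hst : 0 < s - t₁ := sub_pos.2 ht₁s
  by_cases hdd : d' = d
  · subst hdd
    -- The same interface: `p` lies on the hyperplane, and the solution is not unique.
    have hpd : x t₁ ∈ Q d' := hQ.mem_of_le hcd'.symm hS'.symm hpball (by rw [inner_neg_left])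
    exact hne ((hQ.isSwitch hcd' hS).eq_of_isUnique hx hM ht₁ (ht₁s.trans hsT) hpball
      (le_antisymm hpγ (hS.right _ hpd)) hα hβ)
  have hηr : γ - inner ℝ n (x s) < r / 2 := hcon.trans_le (min_le_left _ _)
  have hhalf : ∀ u : 𝔼, ‖u‖ < r → inner ℝ n' u ≤ 0 → x t₁ + u ∈ Q c := fun u hu hu' =>
    hQ.mem_of_le hcd' hS' (by simpa using hu) (by rw [inner_add_right]; linarith)
  rcases eq_or_le_of_halfBall_subset hr hS.norm_eq hS'.norm_eq (hG.angle n hn n' hn') hhalf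
    hS.left with heq | hge
  · subst heq
    -- The hyperplanes coincide, since the foot of the perpendicular from `x s` lies in both cells.
    have hqin : (inner ℝ n (x s + (γ - inner ℝ n (x s)) • n) : ℝ) = γ := by
      rw [inner_add_right, inner_smul_right, real_inner_self_eq_norm_sq, hS.norm_eq]; ring
    have hqc : x s + (γ - inner ℝ n (x s)) • n ∈ Q c := by
      refine hQ.mem_of_le hcd hS (Metric.mem_ball.2 ?_) hqin.le
      rw [dist_self_add_left, norm_smul, hS.norm_eq, Real.norm_eq_abs,
        abs_of_nonneg (by linarith), mul_one]
      linarith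
    have h1 := hS'.left _ hqc
    rw [hqin] at h1
    have hfar := hQ.half_le_dist hr hcd hS hcd' hdd hηr
    have hdist : r / 2 ≤ M * (s - t₁) := by
      refine hfar.trans ?_
      rw [dist_eq_norm]
      exact hx.1.norm_sub_le_mul hM ht₁ ht₁s.le hsT.le
    rcases hG.speed n hn c with h0 | hκ
    · rw [h0] at hprog; linarith
    · rw [abs_of_nonpos hα] at hκ
      have h4 : r / 2 / M ≤ s - t₁ := by
        rw [div_le_iff₀ hM0]; linarith
      have h5 : κ * (r / 2 / M) ≤ -inner ℝ n (vel c) * (s - t₁) :=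
        mul_le_mul hκ h4 (by positivity) (by linarith)
      have h6 : clearance κ M r ≤ κ * (r / 2 / M) := (min_le_right _ _).trans (min_le_right _ _)
      linarith
  · have h5 : clearance κ M r ≤ min (r / 2) (r * κ / 2) :=
      le_min (min_le_left _ _) ((min_le_right _ _).trans (min_le_left _ _))
    have h6 := mul_nonneg hst.le (neg_nonneg.2 hα)
    linarith

/-! ### Error propagation over a short time window -/

lemma norm_iterates_add_sub_le {M ε : ℝ} (hM : ∀ y, ‖v y‖ ≤ M) (hε : 0 < ε) (x₀ : 𝔼) (k₀ k : ℕ) :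
    ‖iterates v ε x₀ (k₀ + k) - iterates v ε x₀ k₀‖ ≤ M * (k * ε) := by
  induction k with
  | zero => simp
  | succ k ih =>
    rw [← add_assoc, iterates, add_sub_right_comm]
    refine (norm_add_le _ _).trans ?_
    rw [norm_smul, Real.norm_eq_abs, abs_of_pos hε]
    have := mul_le_mul_of_nonneg_left (hM (iterates v ε x₀ (k₀ + k))) hε.le
    push_cast
    linarith

/-- The factor by which the error may grow in a window. -/
def windowFactor (κ M : ℝ) : ℝ :=
  1 + (1 + 2 * (2 * M / κ) + 2 * M / κ * M) +
    (1 + 2 * M / κ) * (1 + 2 * M / κ + 2 * M)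

lemma one_le_windowFactor {κ M : ℝ} (hκ : 0 < κ) (hM : 0 < M) : 1 ≤ windowFactor κ M := by
  unfold windowFactor
  have : 0 ≤ (1 + 2 * (2 * M / κ) + 2 * M / κ * M) +
    (1 + 2 * M / κ) * (1 + 2 * M / κ + 2 * M) := by positivity
  linarith

/-- In a time window that is too short for meeting a third cell, the error grows at most by a
fixed factor, provided that it is small enough not to carry the Euler iterates across a
hyperplane that the solution does not meet. -/
lemma window_error_le (hQ : IsCellField v lab Q vel) (hG : IsGap Q vel N κ) {T M r ε : ℝ}
    {x : ℝ → 𝔼} (hx : IsUniqueFilippovSolution v T x) (hM : ∀ y, ‖v y‖ ≤ M)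
    (hvel : ∀ c, ‖vel c‖ ≤ M) (hM0 : 0 < M) (hr : 0 < r)
    (hloc : ∀ t ∈ Icc 0 T, ∃ c d, OnlyLabels lab (x t) r c d) (hε : 0 < ε) {k₀ k₁ : ℕ}
    (hT : k₀ * ε + k₁ * ε ≤ T) (hstep : M * (k₁ * ε) ≤ r / 4)
    (he : ‖iterates v ε (x 0) k₀ - x (k₀ * ε)‖ < r / 4)
    (he' : ‖iterates v ε (x 0) k₀ - x (k₀ * ε)‖ < clearance κ M r) :
    ∀ k ≤ k₁, ‖iterates v ε (x 0) (k₀ + k) - x (k₀ * ε + k * ε)‖ ≤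
      windowFactor κ M * (‖iterates v ε (x 0) k₀ - x (k₀ * ε)‖ + ε) := by
  have hκ := hG.pos
  set X : ℕ → 𝔼 := fun k => iterates v ε (x 0) (k₀ + k) with hXdef
  set a : ℝ := k₀ * ε with ha_def
  have hX0 : X 0 = iterates v ε (x 0) k₀ := rfl
  rw [← hX0] at he he' ⊢
  change ∀ k ≤ k₁, ‖X k - x (a + k * ε)‖ ≤ _
  have ha : 0 ≤ a := by positivity
  have hk₁ : (0 : ℝ) ≤ k₁ * ε := by positivity
  have hball : ∀ t ∈ Icc a (a + k₁ * ε), x t ∈ Metric.ball (x a) r := by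
    intro t ht
    rw [Metric.mem_ball, dist_eq_norm]
    refine (hx.1.norm_sub_le_mul hM ha ht.1 (ht.2.trans hT)).trans_lt ?_
    have := mul_le_mul_of_nonneg_left (by linarith [ht.2] : t - a ≤ k₁ * ε) hM0.le
    linarith
  have hX : ∀ k < k₁, X k ∈ Metric.ball (x a) r := by
    intro k hk
    rw [Metric.mem_ball]
    have h1 := norm_iterates_add_sub_le hM hε (x 0) k₀ k
    have h2 : M * (k * ε) ≤ M * (k₁ * ε) := by gcongr
    have h3 := dist_triangle (X k) (X 0) (x a)
    rw [dist_eq_norm (X 0), dist_eq_norm (X k) (X 0)] at h3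
    have h4 : ‖X k - X 0‖ ≤ M * (k * ε) := h1
    linarith
  have hXs : ∀ k < k₁, X (k + 1) = X k + ε • v (X k) := fun k _ => rfl
  have hF : 1 ≤ windowFactor κ M := one_le_windowFactor hκ hM0
  have hsum : 0 ≤ ‖X 0 - x a‖ + ε := by positivity
  have hexact : (∀ k ≤ k₁, X k - x (a + k * ε) = X 0 - x a) →
      ∀ k ≤ k₁, ‖X k - x (a + k * ε)‖ ≤ windowFactor κ M * (‖X 0 - x a‖ + ε) := by
    intro h k hk
    rw [h k hk]
    nlinarith
  rcases Nat.eq_zero_or_pos k₁ with rfl | hk₁pos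
  · refine hexact fun k hk => ?_
    obtain rfl : k = 0 := by omega
    simp
  have haT : a < T := by
    have : (0 : ℝ) < k₁ * ε := by positivity
    linarith
  obtain ⟨c, d, hcd⟩ := hloc a ⟨ha, haT.le⟩
  rcases hQ.subset_interior_or_separates hG hcd with ⟨e, hsub⟩ | ⟨n, hn, γ, hS⟩
  · exact hexact (hx.1.error_eq_of_const hε (fun y hy => by
      rw [hQ.eq_vel, hQ.lab_eq e y (hsub hy)]) ha hT hball hX hXs)
  by_cases hne : vel c = vel d
  · exact hexact (hx.1.error_eq_of_const hε (w := vel d) (fun y hy => by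
      rw [hQ.eq_vel]
      rcases hcd y hy with e | e <;> rw [e]
      exact hne) ha hT hball hX hXs)
  have h4 : 0 ≤ 2 * M / κ := by positivity
  have h5 : 0 ≤ 1 + 2 * (2 * M / κ) + 2 * M / κ * M := by positivity
  have h6 : 0 ≤ (1 + 2 * M / κ) * (1 + 2 * M / κ + 2 * M) := by positivity
  -- Up to exchanging the sides, the left velocity points towards the hyperplane, or the solution
  -- starts on the left and neither velocity points towards the hyperplane.
  have main : ∀ (c d : ι) (n : 𝔼) (γ : ℝ), OnlyLabels lab (x a) r c d → n ∈ N →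
      Separates Q c d n γ → vel c ≠ vel d →
      (0 < inner ℝ n (vel c) ∨
        (inner ℝ n (vel c) ≤ 0 ∧ 0 ≤ inner ℝ n (vel d) ∧ inner ℝ n (x a) < γ)) →
      ∀ k ≤ k₁, ‖X k - x (a + k * ε)‖ ≤ windowFactor κ M * (‖X 0 - x a‖ + ε) := by
    intro c d n γ hcd hn hS hne hor
    have hsw := hQ.isSwitch hcd hS
    rcases hor with hα | ⟨hα, hβ, hlt⟩
    · have hακ : κ ≤ inner ℝ n (vel c) := by
        rcases hG.speed n hn c with h | h
        · exact absurd h hα.ne'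
        · rwa [abs_of_pos hα] at h
      rcases le_or_gt (inner ℝ n (vel d) : ℝ) 0 with hβ | hβ
      · intro k hk
        refine (hsw.error_le_of_attracting hx.1 (hvel c) (hvel d) hκ hε ha hT hball hX hXs hακ hβ
          k hk).trans (mul_le_mul_of_nonneg_right ?_ hsum)
        unfold windowFactor; linarith
      · have hβκ : κ ≤ inner ℝ n (vel d) := by
          rcases hG.speed n hn d with h | h
          · exact absurd h hβ.ne'
          · rwa [abs_of_pos hβ] at h
        intro k hk
        refine (hsw.error_le_of_crossing hx.1 (hvel c) (hvel d) hκ hε ha hT hball hX hXs hακ hβκ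
          k hk).trans (mul_le_mul_of_nonneg_right ?_ hsum)
        unfold windowFactor; linarith
    · refine hexact (hsw.sub_eq_of_moves_away_of_lt hx.1 hε ha hT hball hX hXs hα ?_)
      by_cases hint : ∀ t ∈ Icc 0 a, ∃ e, x t ∈ interior (Q e)
      · have h7 : X 0 = x a :=
          hQ.iterates_eq_of_mem_interior hx.1 haT.le hε hint k₀ le_rfl
        rw [h7, sub_self, norm_zero]
        linarith
      · push Not at hint
        obtain ⟨t₀, ht₀, hout⟩ := hint
        exact he'.trans_le (clearance_le hQ hG hx hM hM0 hr hloc haT hcd hn hS hne hα hβ hlt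
          ht₀ hout)
  have main' := main d c (-n) (-γ) hcd.symm (hG.neg_mem n hn) hS.symm (Ne.symm hne)
  simp only [inner_neg_left, neg_lt_neg_iff] at main'
  rcases lt_or_ge 0 (inner ℝ n (vel c) : ℝ) with hα | hα
  · exact main c d n γ hcd hn hS hne (Or.inl hα)
  rcases lt_or_ge (inner ℝ n (vel d) : ℝ) 0 with hβ | hβ
  · exact main' (Or.inl (by linarith))
  rcases lt_trichotomy (inner ℝ n (x a) : ℝ) γ with h | h | h
  · exact main c d n γ hcd hn hS hne (Or.inr ⟨hα, hβ, h⟩)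
  · exact absurd ((hQ.isSwitch hcd hS).eq_of_isUnique hx hM ha haT (Metric.mem_ball_self hr) h
      hα hβ) hne
  · exact main' (Or.inr ⟨by linarith, by linarith, h⟩)

/-! ### Accumulation over the windows -/

/-- A bound, in units of the step size, for the error after `j` windows. -/
def accumulated (L : ℝ) : ℕ → ℝ
  | 0 => 1
  | j + 1 => L * (accumulated L j + 1)

lemma accumulated_pos {L : ℝ} (hL : 1 ≤ L) (j : ℕ) : 0 < accumulated L j := by
  induction j with
  | zero => exact one_pos
  | succ j ih => rw [accumulated]; positivity

lemma accumulated_le_succ {L : ℝ} (hL : 1 ≤ L) (j : ℕ) :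
    accumulated L j ≤ accumulated L (j + 1) := by
  have := accumulated_pos hL j
  rw [accumulated]
  nlinarith

/-- Euler's method has order one for cell fields, uniformly over the unique solutions near which at
most two labels occur in balls of a fixed radius. -/
theorem IsCellField.exists_euler_error_le [Finite ι] (hQ : IsCellField v lab Q vel) {T r : ℝ}
    (hr : 0 < r) :
    ∃ ε₀ : ℝ, 0 < ε₀ ∧ ∃ C : ℝ, 0 < C ∧ ∀ x : ℝ → 𝔼, IsUniqueFilippovSolution v T x →
      (∀ t ∈ Icc 0 T, ∃ c d, OnlyLabels lab (x t) r c d) →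
      ∀ ε : ℝ, 0 < ε → ε ≤ ε₀ → ∀ t ∈ Icc 0 T,
        ‖interpolation v ε (x 0) t - x t‖ ≤ C * ε := by
  obtain ⟨N, κ, hG⟩ := hQ.exists_isGap
  have hκ := hG.pos
  obtain ⟨M, hM0, hvel⟩ : ∃ M, 0 < M ∧ ∀ c, ‖vel c‖ ≤ M := by
    obtain ⟨M, hM⟩ := (finite_range fun c => ‖vel c‖).bddAbove
    exact ⟨max M 1, by positivity, fun c => (hM ⟨c, rfl⟩).trans (le_max_left _ _)⟩
  have hM : ∀ y, ‖v y‖ ≤ M := fun y => by rw [hQ.eq_vel]; exact hvel _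
  set L := windowFactor κ M with hL
  have hL1 : 1 ≤ L := one_le_windowFactor hκ hM0
  set h := r / 4 / M with hh
  have hh0 : 0 < h := by positivity
  obtain ⟨J, hJ⟩ := exists_nat_ge (T / (h / 2))
  have hJT : T ≤ J * (h / 2) := (div_le_iff₀ (by positivity)).1 hJ
  have hCpos := accumulated_pos hL1 J
  have hδ : 0 < min (r / 4) (clearance κ M r) := lt_min (by positivity) (clearance_pos hκ hM0 hr)
  refine ⟨min (h / 2) (min (r / 4) (clearance κ M r) / (2 * accumulated L J)), by positivity,
    accumulated L J + 2 * M, by positivity, ?_⟩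
  intro x hx hloc ε hε hεle t ht
  have hεh : ε ≤ h / 2 := hεle.trans (min_le_left _ _)
  have hεδ : accumulated L J * ε < min (r / 4) (clearance κ M r) := by
    have := (le_div_iff₀ (by positivity)).1 (hεle.trans (min_le_right _ _))
    linarith
  -- Every window consists of `p` steps and has a length between `h / 2` and `h`.
  set p := ⌊h / ε⌋₊ with hp
  have hph : p * ε ≤ h := (le_div_iff₀ hε).1 (Nat.floor_le (by positivity))
  have hph' : h / 2 ≤ p * ε := by
    have := (div_lt_iff₀ hε).1 (Nat.lt_floor_add_one (h / ε))
    linarith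
  have hgrid : ∀ j ≤ J, ∀ k : ℕ, k ≤ j * p → k * ε ≤ T →
      ‖iterates v ε (x 0) k - x (k * ε)‖ ≤ accumulated L j * ε := by
    intro j
    induction j with
    | zero =>
      intro _ k hk _
      obtain rfl : k = 0 := by omega
      simp only [iterates, Nat.cast_zero, zero_mul, sub_self, norm_zero]
      exact mul_nonneg (accumulated_pos hL1 0).le hε.le
    | succ j ih =>
      intro hj k hk hkT
      have hmono : ∀ i ≤ J, accumulated L i ≤ accumulated L J := fun i hi =>
        monotone_nat_of_le_succ (accumulated_le_succ hL1) hi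
      have ih := ih (by omega)
      rcases le_total k (j * p) with hkj | hkj
      · exact (ih k hkj hkT).trans
          (mul_le_mul_of_nonneg_right (accumulated_le_succ hL1 j) hε.le)
      · obtain ⟨i, rfl⟩ := Nat.exists_eq_add_of_le hkj
        have hi : i ≤ p := by
          rw [add_mul, one_mul] at hk; omega
        rw [Nat.cast_add, add_mul] at hkT ⊢
        have hiε : (0 : ℝ) ≤ i * ε := by positivity
        have he := ih (j * p) le_rfl (by linarith)
        have heJ : ‖iterates v ε (x 0) (j * p) - x (((j * p : ℕ) : ℝ) * ε)‖ <
            min (r / 4) (clearance κ M r) :=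
          he.trans_lt ((mul_le_mul_of_nonneg_right (hmono j (by omega)) hε.le).trans_lt hεδ)
        have hstep : M * (i * ε) ≤ r / 4 := by
          have h1 : (i : ℝ) * ε ≤ p * ε := by gcongr
          have h2 : M * h = r / 4 := by rw [hh]; field_simp
          rw [← h2]
          exact mul_le_mul_of_nonneg_left (h1.trans hph) hM0.le
        refine (window_error_le hQ hG hx hM hvel hM0 hr hloc hε hkT hstep
          (heJ.trans_le (min_le_left _ _)) (heJ.trans_le (min_le_right _ _)) i le_rfl).trans ?_
        rw [accumulated, mul_assoc]
        refine mul_le_mul_of_nonneg_left ?_ (by linarith)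
        linarith
  refine (norm_interpolation_sub_le (M := M) hε (C := accumulated L J * ε) ?_ (fun k _ => hM _)
    (fun a b ha hab hb => hx.1.norm_sub_le_mul hM ha hab hb) ht).trans (le_of_eq (by ring))
  intro k hkT
  refine hgrid J le_rfl k ?_ hkT
  have h1 : (J : ℝ) * (h / 2) ≤ J * (p * ε) := by gcongr
  have h2 : (k : ℝ) * ε ≤ (J * p : ℕ) * ε := by push_cast; linarith
  exact_mod_cast le_of_mul_le_mul_right h2 hε

end

section

/-! ### The flow field of two finite sets -/

/-- The closed Voronoi cell of `s` with respect to `S`. -/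
def voronoiCell (S : Set (EuclideanSpace ℝ (Fin m))) (s : 𝔼) : Set (EuclideanSpace ℝ (Fin m)) :=
  {y | ∀ s' ∈ S, dist y s ≤ dist y s'}

lemma dist_le_dist_iff_inner_le (y s s' : 𝔼) :
    dist y s ≤ dist y s' ↔ inner ℝ (s' - s) y ≤ (‖s'‖ ^ 2 - ‖s‖ ^ 2) / 2 := by
  rw [dist_eq_norm, dist_eq_norm, ← abs_norm, ← abs_norm (y - s'), ← sq_le_sq,
    norm_sub_sq_real, norm_sub_sq_real, inner_sub_left, real_inner_comm y s', real_inner_comm y s]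
  constructor <;> intro h <;> linarith

lemma isClosed_voronoiCell (S : Set (EuclideanSpace ℝ (Fin m))) (s : 𝔼) :
    IsClosed (voronoiCell S s) := by
  have : voronoiCell S s = ⋂ s' ∈ S, {y | dist y s ≤ dist y s'} := by
    ext y; simp [voronoiCell]
  rw [this]
  exact isClosed_biInter fun s' _ => isClosed_le (by fun_prop) (by fun_prop)

lemma convex_voronoiCell (S : Set (EuclideanSpace ℝ (Fin m))) (s : 𝔼) :
    Convex ℝ (voronoiCell S s) := by
  intro y hy y' hy' p q hp hq hpq s' hs'
  have h1 := (dist_le_dist_iff_inner_le _ _ _).1 (hy s' hs')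
  have h2 := (dist_le_dist_iff_inner_le _ _ _).1 (hy' s' hs')
  rw [dist_le_dist_iff_inner_le, inner_add_right, inner_smul_right, inner_smul_right]
  obtain rfl : p = 1 - q := by linarith
  have h3 := mul_le_mul_of_nonneg_left h1 hp
  have h4 := mul_le_mul_of_nonneg_left h2 hq
  linarith

lemma eq_of_mem_interior_voronoiCell {S : Set (EuclideanSpace ℝ (Fin m))} {s y p : 𝔼}
    (hs : s ∈ S) (hy : y ∈ interior (voronoiCell S s)) (hp : p ∈ nearestPoints S y) : p = s := by
  have hc : Filter.Tendsto (fun σ : ℝ => y + σ • (p - s)) (𝓝[>] 0) (𝓝 y) := by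
    have : ContinuousAt (fun σ : ℝ => y + σ • (p - s)) 0 := by fun_prop
    simpa [ContinuousAt] using this.tendsto.mono_left nhdsWithin_le_nhds
  obtain ⟨σ, hσ, hσ0⟩ :=
    ((hc.eventually (isOpen_interior.mem_nhds hy)).and self_mem_nhdsWithin).exists
  have hσ0 : 0 < σ := hσ0
  have h1 := (dist_le_dist_iff_inner_le _ _ _).1 (interior_subset hσ p hp.1)
  have h2 := (dist_le_dist_iff_inner_le _ _ _).1 (hp.2 s hs)
  rw [inner_add_right, inner_smul_right, real_inner_self_eq_norm_sq] at h1
  rw [← neg_sub p s, inner_neg_left] at h2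
  have h3 : σ * ‖p - s‖ ^ 2 ≤ 0 := by linarith
  have h4 : ‖p - s‖ ^ 2 ≤ 0 := nonpos_of_mul_nonpos_right h3 hσ0
  have h5 : ‖p - s‖ = 0 := pow_eq_zero_iff two_ne_zero |>.1 (le_antisymm h4 (by positivity))
  exact sub_eq_zero.1 (norm_eq_zero.1 h5)

variable {A B : Set (EuclideanSpace ℝ (Fin m))}
  {pA pB : EuclideanSpace ℝ (Fin m) → EuclideanSpace ℝ (Fin m)}

/-- The pair of nearest points selected at `y`. -/
def selectedPair (hpA : IsMetricProjection A pA) (hpB : IsMetricProjection B pB) (y : 𝔼) : A × B :=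
  (⟨pA y, (hpA y).1⟩, ⟨pB (reflector pA y), (hpB _).1⟩)

/-- The closed polyhedron on which `a` is a nearest point of `A`, and `b` is a nearest point of `B`
after reflection in `a`. It contains the W-domain of `(a, b)`. -/
def closedCell (A B : Set (EuclideanSpace ℝ (Fin m))) (c : A × B) : Set 𝔼 :=
  voronoiCell A c.1 ∩ (fun y : 𝔼 => (2 : ℝ) • (c.1 : 𝔼) - y) ⁻¹' voronoiCell B c.2

lemma sub_mem_interior_of_mem_interior_preimage {S : Set 𝔼} {p y : 𝔼}
    (h : y ∈ interior ((fun w : 𝔼 => p - w) ⁻¹' S)) : p - y ∈ interior S := by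
  have h1 : (fun w : 𝔼 => p - w) ⁻¹' S = (Homeomorph.subLeft p) ⁻¹' S := rfl
  rw [h1, ← Homeomorph.preimage_interior] at h
  exact h

lemma isClosed_closedCell (c : A × B) : IsClosed (closedCell A B c) :=
  (isClosed_voronoiCell _ _).inter ((isClosed_voronoiCell _ _).preimage (by fun_prop))

lemma convex_preimage_sub {S : Set 𝔼} (hS : Convex ℝ S) (p : 𝔼) :
    Convex ℝ ((fun w : 𝔼 => p - w) ⁻¹' S) := by
  intro y hy y' hy' a b ha hb hab
  have e : p - (a • y + b • y') = a • (p - y) + b • (p - y') := by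
    rw [smul_sub, smul_sub, sub_add_sub_comm, ← add_smul, hab, one_smul]
  rw [mem_preimage, e]
  exact hS hy hy' ha hb hab

lemma convex_closedCell (c : A × B) : Convex ℝ (closedCell A B c) :=
  (convex_voronoiCell _ _).inter (convex_preimage_sub (convex_voronoiCell _ _) _)

lemma selectedPair_eq_of_mem_interior (hpA : IsMetricProjection A pA)
    (hpB : IsMetricProjection B pB) {c : A × B} {y : 𝔼} (hy : y ∈ interior (closedCell A B c)) :
    selectedPair hpA hpB y = c := by
  rw [closedCell, interior_inter] at hy
  have hA : pA y = c.1 := eq_of_mem_interior_voronoiCell c.1.2 hy.1 (hpA y)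
  have hR : reflector pA y = (2 : ℝ) • (c.1 : 𝔼) - y := by rw [reflector, hA]
  have hB : pB (reflector pA y) = c.2 := by
    refine eq_of_mem_interior_voronoiCell c.2.2 ?_ (hpB (reflector pA y))
    rw [hR]
    exact sub_mem_interior_of_mem_interior_preimage hy.2
  exact Prod.ext (Subtype.ext hA) (Subtype.ext hB)

lemma isCellField_flowField (hpA : IsMetricProjection A pA) (hpB : IsMetricProjection B pB) :
    IsCellField (flowField pA pB) (selectedPair hpA hpB) (closedCell A B)
      (fun c => (c.2 : 𝔼) - c.1) where
  isClosed := isClosed_closedCell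
  convex := convex_closedCell
  mem y := ⟨(hpA y).2, (hpB (reflector pA y)).2⟩
  lab_eq _ _ hy := selectedPair_eq_of_mem_interior hpA hpB hy
  eq_vel _ := rfl

/-- Away from the junctions, at most two labels occur near every point. -/
lemma eventually_selectedPair_eq [Finite A] [Finite B] (hpA : IsMetricProjection A pA)
    (hpB : IsMetricProjection B pB) {z : 𝔼} (hz : z ∉ multiwayJunctions A B pA pB) :
    ∃ c d, ∀ᶠ y in 𝓝 z, selectedPair hpA hpB y = c ∨ selectedPair hpA hpB y = d := by
  set near : Set (𝔼 × 𝔼) := {c | c ∈ A ×ˢ B ∧ z ∈ closure (wDomain pA pB c.1 c.2)} with hnear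
  have htwo : ∃ c d : A × B, ∀ e : A × B, z ∈ closure (wDomain pA pB e.1 e.2) → e = c ∨ e = d := by
    by_contra! hcon
    have hc := hcon (selectedPair hpA hpB z) (selectedPair hpA hpB z)
    obtain ⟨d, hd, hdc, -⟩ := hc
    obtain ⟨e, he, hec, hed⟩ := hcon (selectedPair hpA hpB z) d
    set c := selectedPair hpA hpB z with hcdef
    have hcmem : z ∈ closure (wDomain pA pB c.1 c.2) := subset_closure ⟨rfl, rfl⟩
    have hinj : ∀ {p q : A × B}, p ≠ q → ((p.1 : 𝔼), (p.2 : 𝔼)) ≠ ((q.1 : 𝔼), (q.2 : 𝔼)) := by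
      intro p q hpq h
      exact hpq (Prod.ext (Subtype.ext (congrArg Prod.fst h)) (Subtype.ext (congrArg Prod.snd h)))
    have hsub : ({((c.1 : 𝔼), (c.2 : 𝔼)), ((d.1 : 𝔼), (d.2 : 𝔼)), ((e.1 : 𝔼), (e.2 : 𝔼))} :
        Set (𝔼 × 𝔼)) ⊆ near := by
      rintro _ (rfl | rfl | rfl)
      exacts [⟨⟨c.1.2, c.2.2⟩, hcmem⟩, ⟨⟨d.1.2, d.2.2⟩, hd⟩, ⟨⟨e.1.2, e.2.2⟩, he⟩]
    have hcard := Set.encard_le_encard hsub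
    rw [(Set.encard_eq_three).2 ⟨_, _, _, hinj hdc.symm, hinj hec.symm, hinj hed.symm, rfl⟩] at hcard
    exact hz hcard
  obtain ⟨c, d, hcd⟩ := htwo
  refine ⟨c, d, ?_⟩
  have hev : ∀ᶠ y in 𝓝 z, ∀ e : A × B, y ∈ wDomain pA pB e.1 e.2 → e = c ∨ e = d := by
    rw [Filter.eventually_all]
    intro e
    by_cases he : z ∈ closure (wDomain pA pB e.1 e.2)
    · exact Filter.Eventually.of_forall fun _ _ => hcd e he
    · filter_upwards [isClosed_closure.isOpen_compl.mem_nhds he] with y hy hy'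
      exact absurd (subset_closure hy') hy
  filter_upwards [hev] with y hy
  exact hy (selectedPair hpA hpB y) ⟨rfl, rfl⟩

lemma exists_uniform_onlyLabels {ι : Type*} {lab : 𝔼 → ι} {S : Set 𝔼} (hS : IsCompact S)
    (h : ∀ z ∈ S, ∃ c d, ∀ᶠ y in 𝓝 z, lab y = c ∨ lab y = d) :
    ∃ r > 0, ∀ z ∈ S, ∃ c d, OnlyLabels lab z r c d := by
  refine hS.induction_on (p := fun S => ∃ r > 0, ∀ z ∈ S, ∃ c d, OnlyLabels lab z r c d)
    ⟨1, one_pos, by simp⟩ ?_ ?_ ?_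
  · rintro s t hst ⟨r, hr, H⟩
    exact ⟨r, hr, fun z hz => H z (hst hz)⟩
  · rintro s t ⟨r, hr, H⟩ ⟨r', hr', H'⟩
    refine ⟨min r r', lt_min hr hr', ?_⟩
    rintro z (hz | hz)
    · obtain ⟨c, d, hcd⟩ := H z hz
      exact ⟨c, d, fun y hy => hcd y (Metric.ball_subset_ball (min_le_left _ _) hy)⟩
    · obtain ⟨c, d, hcd⟩ := H' z hz
      exact ⟨c, d, fun y hy => hcd y (Metric.ball_subset_ball (min_le_right _ _) hy)⟩
  · intro z hz
    obtain ⟨c, d, hcd⟩ := h z hz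
    obtain ⟨r, hr, hsub⟩ := Metric.mem_nhds_iff.1 hcd
    refine ⟨Metric.ball z (r / 2),
      mem_nhdsWithin_of_mem_nhds (Metric.ball_mem_nhds _ (by positivity)), r / 2, by positivity,
      fun y hy => ⟨c, d, fun w hw => hsub (Metric.ball_subset_ball' ?_ hw)⟩⟩
    have := Metric.mem_ball.1 hy
    linarith

/-- For finite sets, Euler's method has order one, uniformly over the initial values in a compact set
and the unique Filippov solutions that keep a fixed distance from the multiway junctions. -/
theorem euler_approximation_of_finite (hpA : IsMetricProjection A pA)
    (hpB : IsMetricProjection B pB) (hA : A.Finite) (hB : B.Finite)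
    {K : Set (EuclideanSpace ℝ (Fin m))} (hK : IsCompact K) (T : ℝ) {δ₀ : ℝ} (hδ₀ : 0 < δ₀) :
    ∃ ε₀ : ℝ, 0 < ε₀ ∧ ∃ C : ℝ, 0 < C ∧ ∀ x₀ ∈ K, ∀ x : ℝ → 𝔼,
      IsUniqueFilippovSolution (flowField pA pB) T x → x 0 = x₀ →
      (∀ t ∈ Icc 0 T, ∀ j ∈ multiwayJunctions A B pA pB, δ₀ ≤ dist (x t) j) →
      ∀ ε : ℝ, 0 < ε → ε ≤ ε₀ → ∀ t ∈ Icc 0 T,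
        ‖interpolation (flowField pA pB) ε x₀ t - x t‖ ≤ C * ε := by
  have : Finite A := hA
  have : Finite B := hB
  have hQ := isCellField_flowField hpA hpB
  obtain ⟨M, hM⟩ : ∃ M, ∀ y, ‖flowField pA pB y‖ ≤ M := by
    obtain ⟨M, hM⟩ := (finite_range fun c : A × B => ‖(c.2 : 𝔼) - c.1‖).bddAbove
    exact ⟨M, fun y => hM ⟨selectedPair hpA hpB y, rfl⟩⟩
  have hM0 : 0 ≤ M := (norm_nonneg _).trans (hM 0)
  obtain ⟨R, hR⟩ := hK.isBounded.subset_closedBall (0 : 𝔼)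
  -- All the solutions in question stay in the following compact set.
  set S : Set 𝔼 := Metric.closedBall 0 (R + M * T) ∩
    ⋂ j ∈ multiwayJunctions A B pA pB, {y | δ₀ ≤ dist y j} with hS
  have hSc : IsCompact S := (isCompact_closedBall _ _).inter_right
    (isClosed_biInter fun j _ => isClosed_le continuous_const (by fun_prop))
  obtain ⟨r, hr, hloc⟩ := exists_uniform_onlyLabels hSc
    (lab := selectedPair hpA hpB) fun z hz => by
      refine eventually_selectedPair_eq hpA hpB fun hzJ => ?_
      have := mem_iInter₂.1 hz.2 z hzJ
      rw [mem_ofPred_eq, dist_self] at this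
      linarith
  obtain ⟨ε₀, hε₀, C, hC, H⟩ := hQ.exists_euler_error_le (T := T) hr
  refine ⟨ε₀, hε₀, C, hC, ?_⟩
  rintro _ hx₀ x hx rfl hJ ε hε hle t ht
  refine H x hx (fun s hs => hloc _ ⟨?_, mem_iInter₂.2 fun j hj => hJ s hs j hj⟩) ε hε hle t ht
  have h1 := hx.1.norm_sub_le_mul hM le_rfl hs.1 hs.2
  have h2 : ‖x 0‖ ≤ R := by simpa using hR hx₀
  have h3 : M * (s - 0) ≤ M * T := mul_le_mul_of_nonneg_left (by linarith [hs.2]) hM0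
  have h4 := norm_le_norm_add_norm_sub' (x s) (x 0)
  rw [mem_closedBall_zero_iff]
  linarith

end

end RRR

end

theorem theorem3p3 {m : ℕ} (A B : Set (EuclideanSpace ℝ (Fin m)))
    (pA pB : EuclideanSpace ℝ (Fin m) → EuclideanSpace ℝ (Fin m))
    (hpA : RRR.IsMetricProjection A pA) (hpB : RRR.IsMetricProjection B pB)
    (K : Set (EuclideanSpace ℝ (Fin m))) (hK : IsCompact K) (T : ℝ) (hT : 0 < T) :
    -- the smooth transverse case
    (∀ U : Set (EuclideanSpace ℝ (Fin m)), RRR.SmoothTransverseOn A B pA pB U → K ⊆ U →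
      (∀ x₀ ∈ K, ∃ x : ℝ → EuclideanSpace ℝ (Fin m),
        RRR.IsCaratheodorySolution (RRR.flowField pA pB) T x ∧ x 0 = x₀ ∧
          ∀ t ∈ Set.Icc 0 T, x t ∈ U) →
      ∃ ε₀ : ℝ, 0 < ε₀ ∧ ∃ C : ℝ, 0 < C ∧
        ∀ x₀ ∈ K, ∀ x : ℝ → EuclideanSpace ℝ (Fin m),
          RRR.IsCaratheodorySolution (RRR.flowField pA pB) T x → x 0 = x₀ →
          ∀ ε : ℝ, 0 < ε → ε ≤ ε₀ → ∀ t ∈ Set.Icc 0 T,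
            ‖RRR.interpolation (RRR.flowField pA pB) ε x₀ t - x t‖ ≤ C * ε) ∧
    -- the discrete case
    (A.Finite → B.Finite → ∀ δ₀ : ℝ, 0 < δ₀ →
      ∃ ε₀ : ℝ, 0 < ε₀ ∧ ∃ C : ℝ, 0 < C ∧
        ∀ x₀ ∈ K, ∀ x : ℝ → EuclideanSpace ℝ (Fin m),
          RRR.IsUniqueFilippovSolution (RRR.flowField pA pB) T x → x 0 = x₀ →
          (∀ t ∈ Set.Icc 0 T, ∀ j ∈ RRR.multiwayJunctions A B pA pB, δ₀ ≤ dist (x t) j) →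
          ∀ ε : ℝ, 0 < ε → ε ≤ ε₀ → ∀ t ∈ Set.Icc 0 T,
            ‖RRR.interpolation (RRR.flowField pA pB) ε x₀ t - x t‖ ≤ C * ε) :=
  ⟨fun _ hU _ hsol => RRR.euler_approximation_of_contDiffOn hK hU.isOpen hU.contDiffOn_flowField hsol,
    fun hA hB _ hδ₀ => RRR.euler_approximation_of_finite hpA hpB hA hB hK T hδ₀⟩
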